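/- Let $q\in L^1_{loc}(\mathbb R)$ be real-valued and even, and assume that $\tau_q(y)=-y''-qy$ is in the limit circle case at $+\infty$ and at $-\infty$, i.e. for every $\lambda\in\mathbb C$ all solutions of $\tau_q(y)-\lambda y=0$ lie in $L^2((r,\infty))$ and in $L^2((-\infty,r))$ for some $r\in\mathbb R$. Let $\mathcal D_{\max}=\{y\in L^2(\mathbb R): y,y'\in AC_{loc}(\mathbb R),\ \tau_q y\in L^2(\mathbb R)\}$ and $A_{\max}y=\tau_q(y)$ for $y\in\mathcal D_{\max}$. Put $[f,g]_x=\overline{f(x)}g'(x)-\overline{f'(x)}g(x)$ and $[f,g]_{\pm\infty}=\lim_{x\to\pm\infty}[f,g]_x$. Let $w_1,w_2$ be real-valued solutions of $\tau_q(y)=0$, $w_1$ odd and $w_2$ even, with $[w_1,w_2]_{-\infty}=[w_1,w_2]_{\infty}=1$. For $f\in\mathcal D_{\max}$ put $\alpha_j(f)=[w_j,f]_{-\infty}$ and $\beta_j(f)=[w_j,f]_{\infty}$, $j=1,2$ (these limits exist). Let $(\mathcal Pf)(x)=f(-x)$ and $(\mathcal Tf)(x)=\overline{f(x)}$ on $L^2(\mathbb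 R)$. A closed densely defined operator $H$ in $L^2(\mathbb R)$ is called $\mathcal P\mathcal T$ symmetric if for all $f\in\operatorname{dom}H$ one has $\mathcal P\mathcal Tf\in\operatorname{dom}H$ and $\mathcal P\mathcal THf=H\mathcal P\mathcal Tf$; it is called $\mathcal P$-self-adjoint if $\operatorname{dom}H=\operatorname{dom}(H^*\mathcal P)$ and $Hf=\mathcal PH^*\mathcal Pf$ for all $f\in\operatorname{dom}H$. Let $a,b,c,d\in\mathbb C$ and let $\widetilde A$ be the restriction of $A_{\max}$ to one of the two domains given by mixed boundary conditions, $$\left\{f\in\mathcal D_{\max}:\begin{pmatrix}\alpha_1(f)\\ \alpha_2(f)\end{pmatrix}=\begin{bmatrix}a&b\\ c&d\end{bmatrix}\begin{pmatrix}\beta_1(f)\\ \beta_2(f)\end{pmatrix}\right\}\quad\text{or}\quad\left\{f\in\mathcal D_{\max}:\begin{pmatrix}\beta_1(f)\\ \beta_2(f)\end{pmatrix}=\begin{bmatrix}a&b\\ c&d\end{bmatrix}\begin{pmatrix}\alpha_1(f)\\ \alpha_2(f)\end{pmatrix}\right\}.$$ Then: (1) $\widetilde A$ is $\mathcal P\mathcal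 T$ symmetric, self-adjoint and $\mathcal P$-self-adjoint if and only if $a,b,c,d\in\mathbb R$, $a=d$ and $a^2-bc=1$. (2) $\widetilde A$ is self-adjoint and $\mathcal P$-self-adjoint if and only if $a,b,c,d\in\mathbb R$, $a=d$ and $a^2-bc=1$. In this case $\widetilde A$ is also $\mathcal P\mathcal T$ symmetric. (3) $\widetilde A$ is self-adjoint and $\mathcal P\mathcal T$ symmetric if and only if for some $\varphi\in\mathbb R$ the numbers $e^{-i\varphi}a,e^{-i\varphi}b,e^{-i\varphi}c,e^{-i\varphi}d$ are real, $d=e^{2i\varphi}\overline a$ and $ad-bc=e^{2i\varphi}$. (4) $\widetilde A$ is $\mathcal P$-self-adjoint and $\mathcal P\mathcal T$ symmetric if and only if $b,c\in\mathbb R$, $d=\overline a$ and $|a|^2-bc=1$. -/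

import Mathlib

open MeasureTheory Filter Topology
open scoped ComplexConjugate Matrix

noncomputable section

namespace PTQM

/-- The Hilbert space `L²(ℝ)` of complex-valued functions. -/
abbrev L2R : Type := Lp ℂ 2 (volume : Measure ℝ)

/-! ### The operators `P` and `T`, and the three classes of operators in `L²(ℝ)` -/

/-- Parity reflection, `(P f)(x) = f(-x)`. -/
def parity (f : L2R) : L2R :=
  Lp.compMeasurePreserving (fun x : ℝ => -x) (Measure.measurePreserving_neg volume) f

/-- Time reversal, `(T f)(x) = conj (f(x))`. -/
def timeReversal (f : L2R) : L2R := star f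

/-- The product `PT`. -/
def PT (f : L2R) : L2R := parity (timeReversal f)

theorem parity_ae (f : L2R) : ∀ᵐ x : ℝ, parity f x = f (-x) :=
  Lp.coeFn_compMeasurePreserving f (Measure.measurePreserving_neg volume)

theorem timeReversal_ae (f : L2R) : ∀ᵐ x : ℝ, timeReversal f x = conj (f x) :=
  Lp.coeFn_star f

/-- A closed densely defined operator `H` is `PT` symmetric if for all `f ∈ dom H` one has
`PT f ∈ dom H` and `PT H f = H PT f`. -/
def IsPTSymmetric (H : L2R →ₗ.[ℂ] L2R) : Prop :=
  H.IsClosed ∧ Dense (H.domain : Set L2R) ∧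
    ∀ f : H.domain, ∃ h : PT (f : L2R) ∈ H.domain, PT (H f) = H ⟨PT (f : L2R), h⟩

/-- A closed densely defined operator `H` is `P`-self-adjoint if `dom H = dom (H* P)` and
`H f = P H* P f` for all `f ∈ dom H`. -/
def IsPSelfAdjoint (H : L2R →ₗ.[ℂ] L2R) : Prop :=
  H.IsClosed ∧ Dense (H.domain : Set L2R) ∧
    (∀ f : L2R, f ∈ H.domain ↔ parity f ∈ H.adjoint.domain) ∧
    ∀ (f : L2R) (h : f ∈ H.domain) (h' : parity f ∈ H.adjoint.domain),
      H ⟨f, h⟩ = parity (H.adjoint ⟨parity f, h'⟩)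

/-! ### The differential expression -/

/-- `f` is absolutely continuous on every compact interval. -/
def ACLoc (f : ℝ → ℂ) : Prop := ∀ a b : ℝ, AbsolutelyContinuousOnInterval f a b

/-- `y` and `y'` are locally absolutely continuous (`y` is then differentiable everywhere, since
its derivative almost everywhere has a continuous representative). -/
structure IsRegular (y : ℝ → ℂ) : Prop where
  differentiable : Differentiable ℝ y
  ac : ACLoc y
  ac_deriv : ACLoc (deriv y)

/-- The differential expression `τ_q(y) = -y'' - q y`; the second derivative exists almost
everywhere when `y` is regular. -/
def tau (q : ℝ → ℝ) (y : ℝ → ℂ) (x : ℝ) : ℂ := -deriv (deriv y) x - (q x : ℂ) * y x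

/-- `y` is a solution of `τ_q(y) - l y = 0`. -/
def IsSolution (q : ℝ → ℝ) (l : ℂ) (y : ℝ → ℂ) : Prop :=
  IsRegular y ∧ ∀ᵐ x : ℝ, tau q y x - l * y x = 0

/-- Limit circle case at `+∞`. -/
def LimitCircleAtTop (q : ℝ → ℝ) : Prop :=
  ∀ (l : ℂ) (y : ℝ → ℂ), IsSolution q l y →
    ∃ a : ℝ, MemLp y 2 (volume.restrict (Set.Ioi a))

/-- Limit circle case at `-∞`. -/
def LimitCircleAtBot (q : ℝ → ℝ) : Prop :=
  ∀ (l : ℂ) (y : ℝ → ℂ), IsSolution q l y →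
    ∃ a : ℝ, MemLp y 2 (volume.restrict (Set.Iio a))

/-- The maximal domain `D_max`, as a set of functions. -/
structure InMaxDomain (q : ℝ → ℝ) (y : ℝ → ℂ) : Prop where
  memLp : MemLp y 2 volume
  regular : IsRegular y
  memLp_tau : MemLp (tau q y) 2 volume

theorem ACLoc.ae_differentiableAt {f : ℝ → ℂ} (hf : ACLoc f) :
    ∀ᵐ x : ℝ, DifferentiableAt ℝ f x := by
  have h : LocallyBoundedVariationOn f Set.univ := by
    intro a b _ _
    refine ((hf a b).boundedVariationOn).mono ?_
    exact Set.inter_subset_right.trans Set.Icc_subset_uIcc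
  exact h.ae_differentiableAt

theorem ACLoc.add {f g : ℝ → ℂ} (hf : ACLoc f) (hg : ACLoc g) : ACLoc (f + g) :=
  fun a b => (hf a b).add (hg a b)

theorem ACLoc.smul {f : ℝ → ℂ} (c : ℂ) (hf : ACLoc f) : ACLoc (c • f) :=
  fun a b => (hf a b).const_smul c

theorem IsRegular.deriv_add {y z : ℝ → ℂ} (hy : IsRegular y) (hz : IsRegular z) :
    deriv (y + z) = deriv y + deriv z := by
  funext x
  exact _root_.deriv_add (hy.differentiable x) (hz.differentiable x)

theorem IsRegular.deriv_smul {y : ℝ → ℂ} (c : ℂ) (hy : IsRegular y) :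
    deriv (c • y) = c • deriv y := by
  funext x
  exact deriv_const_smul c (hy.differentiable x)

theorem IsRegular.add {y z : ℝ → ℂ} (hy : IsRegular y) (hz : IsRegular z) :
    IsRegular (y + z) where
  differentiable := hy.differentiable.add hz.differentiable
  ac := hy.ac.add hz.ac
  ac_deriv := by
    rw [hy.deriv_add hz]
    exact hy.ac_deriv.add hz.ac_deriv

theorem IsRegular.smul {y : ℝ → ℂ} (c : ℂ) (hy : IsRegular y) : IsRegular (c • y) where
  differentiable := hy.differentiable.const_smul c
  ac := hy.ac.smul c
  ac_deriv := by
    rw [hy.deriv_smul c]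
    exact hy.ac_deriv.smul c

theorem tau_add_ae (q : ℝ → ℝ) {y z : ℝ → ℂ} (hy : IsRegular y) (hz : IsRegular z) :
    tau q (y + z) =ᵐ[volume] tau q y + tau q z := by
  filter_upwards [hy.ac_deriv.ae_differentiableAt, hz.ac_deriv.ae_differentiableAt] with x h1 h2
  simp only [tau, hy.deriv_add hz, Pi.add_apply, _root_.deriv_add h1 h2]
  ring

theorem tau_smul_ae (q : ℝ → ℝ) {y : ℝ → ℂ} (c : ℂ) (hy : IsRegular y) :
    tau q (c • y) =ᵐ[volume] c • tau q y := by
  filter_upwards [hy.ac_deriv.ae_differentiableAt] with x h1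
  simp only [tau, hy.deriv_smul c, Pi.smul_apply, deriv_const_smul c h1, smul_eq_mul]
  ring

theorem InMaxDomain.add {q : ℝ → ℝ} {y z : ℝ → ℂ} (hy : InMaxDomain q y)
    (hz : InMaxDomain q z) : InMaxDomain q (y + z) where
  memLp := hy.memLp.add hz.memLp
  regular := hy.regular.add hz.regular
  memLp_tau := (hy.memLp_tau.add hz.memLp_tau).ae_eq (tau_add_ae q hy.regular hz.regular).symm

theorem InMaxDomain.smul {q : ℝ → ℝ} {y : ℝ → ℂ} (c : ℂ) (hy : InMaxDomain q y) :
    InMaxDomain q (c • y) where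
  memLp := hy.memLp.const_smul c
  regular := hy.regular.smul c
  memLp_tau := (hy.memLp_tau.const_smul c).ae_eq (tau_smul_ae q c hy.regular).symm

theorem InMaxDomain.zero (q : ℝ → ℝ) : InMaxDomain q 0 := by
  have h : IsRegular (0 : ℝ → ℂ) := by
    have h0 : ACLoc (0 : ℝ → ℂ) := fun a b => by
      simpa [AbsolutelyContinuousOnInterval] using! tendsto_const_nhds
    have hd : deriv (0 : ℝ → ℂ) = 0 := by
      funext x
      exact deriv_const x (0 : ℂ)
    exact ⟨differentiable_const 0, h0, by rw [hd]; exact h0⟩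
  refine ⟨MemLp.zero, h, ?_⟩
  have ht : tau q 0 =ᵐ[volume] 0 := by
    have := tau_smul_ae q 0 h
    simpa using this
  exact MemLp.zero.ae_eq ht.symm

/-- A regular function is determined by its class in `L²(ℝ)`. -/
theorem IsRegular.eq_of_ae {y z : ℝ → ℂ} (hy : IsRegular y) (hz : IsRegular z)
    (h : y =ᵐ[volume] z) : y = z :=
  (Continuous.ae_eq_iff_eq volume hy.differentiable.continuous hz.differentiable.continuous).1 h

/-! ### The maximal operator -/

/-- The maximal domain `D_max`, as a subspace of `L²(ℝ)`. -/
def maxDomain (q : ℝ → ℝ) : Submodule ℂ L2R where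
  carrier := {f | ∃ y : ℝ → ℂ, InMaxDomain q y ∧ f =ᵐ[volume] y}
  zero_mem' := ⟨0, InMaxDomain.zero q, Lp.coeFn_zero _ _ _⟩
  add_mem' := by
    rintro f g ⟨y, hy, hfy⟩ ⟨z, hz, hgz⟩
    exact ⟨y + z, hy.add hz, (Lp.coeFn_add f g).trans (hfy.add hgz)⟩
  smul_mem' := by
    rintro c f ⟨y, hy, hfy⟩
    exact ⟨c • y, hy.smul c, (Lp.coeFn_smul c f).trans (hfy.const_smul c)⟩

/-- The unique locally absolutely continuous representative of an element of `D_max`. -/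
def rep {q : ℝ → ℝ} (f : maxDomain q) : ℝ → ℂ := f.2.choose

theorem rep_inMaxDomain {q : ℝ → ℝ} (f : maxDomain q) : InMaxDomain q (rep f) :=
  f.2.choose_spec.1

theorem coe_ae_eq_rep {q : ℝ → ℝ} (f : maxDomain q) : (f : L2R) =ᵐ[volume] rep f :=
  f.2.choose_spec.2

theorem rep_eq {q : ℝ → ℝ} (f : maxDomain q) {y : ℝ → ℂ} (hy : IsRegular y)
    (h : (f : L2R) =ᵐ[volume] y) : rep f = y :=
  (rep_inMaxDomain f).regular.eq_of_ae hy ((coe_ae_eq_rep f).symm.trans h)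

theorem rep_add {q : ℝ → ℝ} (f g : maxDomain q) : rep (f + g) = rep f + rep g :=
  rep_eq _ ((rep_inMaxDomain f).regular.add (rep_inMaxDomain g).regular)
    ((Lp.coeFn_add (f : L2R) (g : L2R)).trans ((coe_ae_eq_rep f).add (coe_ae_eq_rep g)))

theorem rep_smul {q : ℝ → ℝ} (c : ℂ) (f : maxDomain q) : rep (c • f) = c • rep f :=
  rep_eq _ ((rep_inMaxDomain f).regular.smul c)
    ((Lp.coeFn_smul c (f : L2R)).trans ((coe_ae_eq_rep f).const_smul c))

/-- The maximal operator: `A_max y = τ_q(y)` for `y ∈ D_max`. -/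
def maxOp (q : ℝ → ℝ) : L2R →ₗ.[ℂ] L2R where
  domain := maxDomain q
  toFun :=
    { toFun := fun f => (rep_inMaxDomain f).memLp_tau.toLp (tau q (rep f))
      map_add' := by
        intro f g
        rw [← MemLp.toLp_add]
        apply MemLp.toLp_congr
        rw [rep_add]
        exact tau_add_ae q (rep_inMaxDomain f).regular (rep_inMaxDomain g).regular
      map_smul' := by
        intro c f
        rw [RingHom.id_apply, ← MemLp.toLp_const_smul]
        apply MemLp.toLp_congr
        rw [rep_smul]
        exact tau_smul_ae q c (rep_inMaxDomain f).regular }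

/-! ### Boundary values and mixed boundary conditions -/

/-- `[f, g]_x = conj (f x) * g' x - conj (f' x) * g x`. -/
def bracket (f g : ℝ → ℂ) (x : ℝ) : ℂ := conj (f x) * deriv g x - conj (deriv f x) * g x

/-- Real-valued solutions `w₁` (odd) and `w₂` (even) of `τ_q(y) = 0` with
`[w₁, w₂]_{-∞} = [w₁, w₂]_{∞} = 1`. (The brackets `[w₁, w₁]` and `[w₂, w₂]` vanish identically,
because `w₁` and `w₂` are real-valued.) -/
structure IsBoundarySystem (q : ℝ → ℝ) (w₁ w₂ : ℝ → ℂ) : Prop where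
  sol₁ : IsSolution q 0 w₁
  sol₂ : IsSolution q 0 w₂
  real₁ : ∀ x, (w₁ x).im = 0
  real₂ : ∀ x, (w₂ x).im = 0
  odd₁ : Function.Odd w₁
  even₂ : Function.Even w₂
  bracket_bot : Tendsto (bracket w₁ w₂) atBot (𝓝 1)
  bracket_top : Tendsto (bracket w₁ w₂) atTop (𝓝 1)

/-- `α = (α₁(y), α₂(y))` and `β = (β₁(y), β₂(y))`, that is `α_j = [w_j, y]_{-∞}` and
`β_j = [w_j, y]_{∞}` (all four limits exist). -/
structure HasBoundaryValues (w₁ w₂ y : ℝ → ℂ) (α β : Fin 2 → ℂ) : Prop where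
  alpha₁ : Tendsto (bracket w₁ y) atBot (𝓝 (α 0))
  alpha₂ : Tendsto (bracket w₂ y) atBot (𝓝 (α 1))
  beta₁ : Tendsto (bracket w₁ y) atTop (𝓝 (β 0))
  beta₂ : Tendsto (bracket w₂ y) atTop (𝓝 (β 1))

theorem bracket_add (w : ℝ → ℂ) {y z : ℝ → ℂ} (hy : IsRegular y) (hz : IsRegular z) :
    bracket w (y + z) = bracket w y + bracket w z := by
  funext x
  simp only [bracket, hy.deriv_add hz, Pi.add_apply]
  ring

theorem bracket_smul (w : ℝ → ℂ) {y : ℝ → ℂ} (c : ℂ) (hy : IsRegular y) :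
    bracket w (c • y) = c • bracket w y := by
  funext x
  simp only [bracket, hy.deriv_smul c, Pi.smul_apply, smul_eq_mul]
  ring

theorem HasBoundaryValues.add {w₁ w₂ y z : ℝ → ℂ} {α β α' β' : Fin 2 → ℂ}
    (hy : IsRegular y) (hz : IsRegular z) (h : HasBoundaryValues w₁ w₂ y α β)
    (h' : HasBoundaryValues w₁ w₂ z α' β') :
    HasBoundaryValues w₁ w₂ (y + z) (α + α') (β + β') := by
  constructor <;> rw [bracket_add _ hy hz]
  exacts [h.alpha₁.add h'.alpha₁, h.alpha₂.add h'.alpha₂, h.beta₁.add h'.beta₁,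
    h.beta₂.add h'.beta₂]

theorem HasBoundaryValues.smul {w₁ w₂ y : ℝ → ℂ} {α β : Fin 2 → ℂ} (c : ℂ)
    (hy : IsRegular y) (h : HasBoundaryValues w₁ w₂ y α β) :
    HasBoundaryValues w₁ w₂ (c • y) (c • α) (c • β) := by
  constructor <;> rw [bracket_smul _ c hy]
  exacts [h.alpha₁.const_smul c, h.alpha₂.const_smul c, h.beta₁.const_smul c,
    h.beta₂.const_smul c]

theorem HasBoundaryValues.zero (w₁ w₂ : ℝ → ℂ) : HasBoundaryValues w₁ w₂ 0 0 0 := by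
  have h : ∀ w : ℝ → ℂ, bracket w 0 = fun _ => 0 := by
    intro w
    simpa using! bracket_smul w 0 (InMaxDomain.zero 0).regular
  constructor <;> rw [h] <;> exact tendsto_const_nhds

/-- The functions in `D_max` whose boundary values `(α, β)` lie in the subspace `S`. -/
def boundaryDomain (q : ℝ → ℝ) (w₁ w₂ : ℝ → ℂ)
    (S : Submodule ℂ ((Fin 2 → ℂ) × (Fin 2 → ℂ))) : Submodule ℂ L2R where
  carrier := {f | ∃ y : ℝ → ℂ, InMaxDomain q y ∧ f =ᵐ[volume] y ∧
    ∃ α β : Fin 2 → ℂ, HasBoundaryValues w₁ w₂ y α β ∧ (α, β) ∈ S}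
  zero_mem' := ⟨0, InMaxDomain.zero q, Lp.coeFn_zero _ _ _, 0, 0,
    HasBoundaryValues.zero w₁ w₂, S.zero_mem⟩
  add_mem' := by
    rintro f g ⟨y, hy, hfy, α, β, h, hS⟩ ⟨z, hz, hgz, α', β', h', hS'⟩
    exact ⟨y + z, hy.add hz, (Lp.coeFn_add f g).trans (hfy.add hgz), α + α', β + β',
      h.add hy.regular hz.regular h', S.add_mem hS hS'⟩
  smul_mem' := by
    rintro c f ⟨y, hy, hfy, α, β, h, hS⟩
    exact ⟨c • y, hy.smul c, (Lp.coeFn_smul c f).trans (hfy.const_smul c), c • α, c • β,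
      h.smul c hy.regular, S.smul_mem c hS⟩

/-- The pairs `(α, β)` with `α = M β`. -/
def mixedRel₁ (M : Matrix (Fin 2) (Fin 2) ℂ) : Submodule ℂ ((Fin 2 → ℂ) × (Fin 2 → ℂ)) where
  carrier := {p | p.1 = M *ᵥ p.2}
  zero_mem' := (Matrix.mulVec_zero M).symm
  add_mem' := by
    intro p p' (h : p.1 = M *ᵥ p.2) (h' : p'.1 = M *ᵥ p'.2)
    change p.1 + p'.1 = M *ᵥ (p.2 + p'.2)
    rw [Matrix.mulVec_add, h, h']
  smul_mem' := by
    intro c p (h : p.1 = M *ᵥ p.2)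
    change c • p.1 = M *ᵥ (c • p.2)
    rw [Matrix.mulVec_smul, h]

/-- The pairs `(α, β)` with `β = M α`. -/
def mixedRel₂ (M : Matrix (Fin 2) (Fin 2) ℂ) : Submodule ℂ ((Fin 2 → ℂ) × (Fin 2 → ℂ)) where
  carrier := {p | p.2 = M *ᵥ p.1}
  zero_mem' := (Matrix.mulVec_zero M).symm
  add_mem' := by
    intro p p' (h : p.2 = M *ᵥ p.1) (h' : p'.2 = M *ᵥ p'.1)
    change p.2 + p'.2 = M *ᵥ (p.1 + p'.1)
    rw [Matrix.mulVec_add, h, h']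
  smul_mem' := by
    intro c p (h : p.2 = M *ᵥ p.1)
    change c • p.2 = M *ᵥ (c • p.1)
    rw [Matrix.mulVec_smul, h]

/-- The restriction of the maximal operator to the functions that satisfy the mixed boundary
condition `(α₁(f), α₂(f))ᵀ = M (β₁(f), β₂(f))ᵀ`. -/
def mixedOp₁ (q : ℝ → ℝ) (w₁ w₂ : ℝ → ℂ) (M : Matrix (Fin 2) (Fin 2) ℂ) : L2R →ₗ.[ℂ] L2R :=
  (maxOp q).domRestrict (boundaryDomain q w₁ w₂ (mixedRel₁ M))

/-- The restriction of the maximal operator to the functions that satisfy the mixed boundary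
condition `(β₁(f), β₂(f))ᵀ = M (α₁(f), α₂(f))ᵀ`. -/
def mixedOp₂ (q : ℝ → ℝ) (w₁ w₂ : ℝ → ℂ) (M : Matrix (Fin 2) (Fin 2) ℂ) : L2R →ₗ.[ℂ] L2R :=
  (maxOp q).domRestrict (boundaryDomain q w₁ w₂ (mixedRel₂ M))

end PTQM

end

noncomputable section

namespace PTQM

/-! ### Calculus of locally absolutely continuous functions -/

/-! Everything is reduced to linear algebra on boundary values. For a subspace `S` of `ℂ² × ℂ²`,
`relOp` restricts the maximal operator to functions with `(α, β) ∈ S`. Since `w₁`, `w₂` have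
Wronskian 1, the Plücker identity turns Green's formula into `⟪τf, g⟫ - ⟪f, τg⟫ = symp β β' - symp α
α'`.

Limit circle at both ends puts `w₁`, `w₂` in `L²`, so variation of constants solves `τy = h` inside
`D_max` for every `h ∈ L²`, with `α` prescribed; `β` is then fixed by the moments of `h` against
`w₁`, `w₂`. Hence every pair `(α, β)` is attained (`exists_hasBoundaryValues`), and the functions
with zero boundary values have range containing `{w₁, w₂}ᗮ`, which forces the adjoint into the
maximal operator (`exists_of_inner_eq`). It follows that the adjoint of `relOp S` is `relOp (orth
S)` (`adjoint_relOp`) and that `S` is determined by its operator.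

Reflection acts on boundary values by `(α, β) ↦ (Rβ, Rα)` with `R = diag(1, -1)`, and `T` acts by
conjugation. For the relation given by `M`, with symplectic adjoint `sharp M`, the three classes
become: self-adjoint iff `sharp M * M = 1`; `P`-self-adjoint iff `R * sharp M * R = M`, that is `d =
conj a` with `b`, `c` real; `PT` symmetric iff `M R conj(M) R = 1`. Both kinds of mixed condition
give the same equations, and the four claims are algebra in `a, b, c, d`. -/

theorem ACLoc.mul {f g : ℝ → ℂ} (hf : ACLoc f) (hg : ACLoc g) : ACLoc (fun x => f x * g x) :=
  fun a b => (hf a b).fun_smul (hg a b)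

theorem ACLoc.sub {f g : ℝ → ℂ} (hf : ACLoc f) (hg : ACLoc g) : ACLoc (fun x => f x - g x) :=
  fun a b => (hf a b).fun_sub (hg a b)

theorem absolutelyContinuousOnInterval_of_dist_le {X : Type*} [PseudoMetricSpace X]
    {f : ℝ → X} {g : ℝ → ℂ} {a b : ℝ}
    (hf : AbsolutelyContinuousOnInterval f a b)
    (h : ∀ x y, dist (g x) (g y) ≤ dist (f x) (f y)) :
    AbsolutelyContinuousOnInterval g a b := by
  rw [absolutelyContinuousOnInterval_iff] at hf ⊢
  intro ε hε
  obtain ⟨δ, hδ, H⟩ := hf ε hε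
  exact ⟨δ, hδ, fun E hE hs => (Finset.sum_le_sum fun i _ => h _ _).trans_lt (H E hE hs)⟩

theorem ACLoc.conj {f : ℝ → ℂ} (hf : ACLoc f) : ACLoc (fun x => conj (f x)) :=
  fun a b => absolutelyContinuousOnInterval_of_dist_le (hf a b) fun x y => by
    rw [Complex.dist_conj_conj]

theorem ACLoc.comp_neg {f : ℝ → ℂ} (hf : ACLoc f) : ACLoc (fun x => f (-x)) := by
  intro a b
  have h := hf (-a) (-b)
  rw [absolutelyContinuousOnInterval_iff] at h ⊢
  intro ε hε
  obtain ⟨δ, hδ, H⟩ := h ε hε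
  refine ⟨δ, hδ, fun E hE hs => ?_⟩
  have hE' : ((E.1, fun i => (-(E.2 i).2, -(E.2 i).1)) : ℕ × (ℕ → ℝ × ℝ)) ∈
      AbsolutelyContinuousOnInterval.disjWithin (-a) (-b) := by
    obtain ⟨h1, h2⟩ := hE
    refine ⟨fun i hi => ?_, fun i hi j hj hij => ?_⟩
    · obtain ⟨h3, h4⟩ := h1 i hi
      simp only [Set.mem_uIcc] at h3 h4 ⊢
      constructor <;> [rcases h4 with h | h; rcases h3 with h | h] <;>
        [right; left; right; left] <;> constructor <;> linarith [h.1, h.2]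
    · have h3 := h2 hi hj hij
      -- Reflection turns `Ioc` into `Ico`, so disjointness is transferred through the endpoint
      -- inequality rather than through images of sets.
      simp only [Function.onFun, Set.uIoc, Set.Ioc_disjoint_Ioc] at h3 ⊢
      simp only [min_neg_neg, max_neg_neg]
      rw [min_comm (E.2 i).2, max_comm (E.2 i).2, min_comm (E.2 j).2, max_comm (E.2 j).2]
      linarith
  have := H _ hE' (by simpa [dist_comm] using hs)
  simpa [dist_comm] using this

theorem acLoc_integral {h : ℝ → ℂ} (hh : LocallyIntegrable h volume) :
    ACLoc (fun x => ∫ t in (0 : ℝ)..x, h t) := by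
  intro a b
  have hi : ∀ a b, IntervalIntegrable h volume a b := fun a b =>
    (hh.integrableOn_isCompact isCompact_uIcc).intervalIntegrable
  have key : ∀ g : ℝ → ℝ, (∀ a b, IntervalIntegrable g volume a b) →
      AbsolutelyContinuousOnInterval (fun x => ((∫ t in (0 : ℝ)..x, g t : ℝ) : ℂ)) a b := by
    intro g hg
    -- The interval is enlarged to contain the base point 0 of the integral; `h0` serves `a ≤ b` and
    -- `h1` serves `b ≤ a`.
    have h0 := ((hg (min a 0) (max b 0)).absolutelyContinuousOnInterval_intervalIntegral
      (c := 0) (Set.mem_uIcc_of_le (min_le_right _ _) (le_max_right _ _)))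
    have h1 := ((hg (min b 0) (max a 0)).absolutelyContinuousOnInterval_intervalIntegral
      (c := 0) (Set.mem_uIcc_of_le (min_le_right _ _) (le_max_right _ _)))
    rcases le_total a b with hab | hab
    · refine absolutelyContinuousOnInterval_of_dist_le (h0.mono ?_) fun x y => by
        rw [Complex.dist_of_im_eq (by simp)]; simp
      rw [Set.uIcc_of_le hab, Set.uIcc_of_le (by simp)]
      exact Set.Icc_subset_Icc (min_le_left _ _) (le_max_left _ _)
    · refine absolutelyContinuousOnInterval_of_dist_le (h1.mono ?_) fun x y => by
        rw [Complex.dist_of_im_eq (by simp)]; simp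
      rw [Set.uIcc_of_ge hab, Set.uIcc_of_le (by simp)]
      exact Set.Icc_subset_Icc (min_le_left _ _) (le_max_left _ _)
  have hre := key (fun t => (h t).re) fun a b =>
    ⟨(hi a b).1.re, (hi a b).2.re⟩
  have him := key (fun t => (h t).im) fun a b =>
    ⟨(hi a b).1.im, (hi a b).2.im⟩
  suffices H : (fun x => ∫ t in (0 : ℝ)..x, h t) = fun x =>
      ((∫ t in (0 : ℝ)..x, (h t).re : ℝ) : ℂ) +
        Complex.I • ((∫ t in (0 : ℝ)..x, (h t).im : ℝ) : ℂ) by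
    rw [H]
    exact hre.fun_add (him.const_smul Complex.I)
  funext x
  rw [← intervalIntegral.integral_ofReal, ← intervalIntegral.integral_ofReal, smul_eq_mul,
    ← intervalIntegral.integral_const_mul, ← intervalIntegral.integral_add]
  · refine intervalIntegral.integral_congr fun t _ => ?_
    rw [mul_comm, Complex.re_add_im]
  · exact ⟨(hi _ _).1.re.ofReal, (hi _ _).2.re.ofReal⟩
  · exact (show IntervalIntegrable (fun t => ((h t).im : ℂ)) volume 0 x from
      ⟨(hi _ _).1.im.ofReal, (hi _ _).2.im.ofReal⟩).const_mul _

/-- The fundamental theorem of calculus for absolutely continuous functions. -/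
theorem ACLoc.integral_eq_sub {f h : ℝ → ℂ} (hf : ACLoc f) (hh : LocallyIntegrable h volume)
    (hd : ∀ᵐ x, HasDerivAt f (h x) x) (a b : ℝ) : ∫ t in a..b, h t = f b - f a := by
  have hi : ∀ a b, IntervalIntegrable h volume a b := fun a b =>
    (hh.integrableOn_isCompact isCompact_uIcc).intervalIntegrable
  have h1 : ∀ᵐ x, x ∈ Set.uIcc a b →
      HasDerivAt (fun x => f x - ∫ t in (0 : ℝ)..x, h t) 0 x := by
    filter_upwards [hd, LocallyIntegrable.ae_hasDerivAt_integral hh] with x h1 h2 _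
    simpa using h1.fun_sub (h2 0)
  obtain ⟨C, hC⟩ := (hf.sub (acLoc_integral hh) a b).const_of_ae_hasDerivAt_zero h1
  have ha := hC a Set.left_mem_uIcc
  have hb := hC b Set.right_mem_uIcc
  rw [← intervalIntegral.integral_interval_sub_left (hi 0 b) (hi 0 a)]
  linear_combination ha - hb

theorem IsRegular.hasDerivAt {y : ℝ → ℂ} (hy : IsRegular y) (x : ℝ) :
    HasDerivAt y (deriv y x) x := (hy.differentiable x).hasDerivAt

theorem IsRegular.ae_hasDerivAt_deriv {y : ℝ → ℂ} (hy : IsRegular y) :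
    ∀ᵐ x, HasDerivAt (deriv y) (deriv (deriv y) x) x := by
  filter_upwards [hy.ac_deriv.ae_differentiableAt] with x hx using hx.hasDerivAt

theorem ACLoc.continuous {f : ℝ → ℂ} (hf : ACLoc f) : Continuous f := by
  rw [continuous_iff_continuousAt]
  intro x
  refine (hf (x - 1) (x + 1)).continuousOn.continuousAt ?_
  rw [Set.uIcc_of_le (by linarith)]
  exact Icc_mem_nhds (by linarith) (by linarith)

/-- An absolutely continuous `y` is the integral of its almost everywhere derivative; as `z` is
continuous, the derivative then exists everywhere. -/
theorem IsRegular.of_ae_hasDerivAt {y z : ℝ → ℂ} (hy : ACLoc y) (hz : ACLoc z)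
    (h : ∀ᵐ x, HasDerivAt y (z x) x) : IsRegular y ∧ deriv y = z := by
  have hd : ∀ x, HasDerivAt y (z x) x := by
    intro x
    have h1 : y = fun x => y 0 + ∫ t in (0 : ℝ)..x, z t := by
      funext x
      rw [hy.integral_eq_sub hz.continuous.locallyIntegrable h]
      ring
    rw [h1]
    exact (intervalIntegral.integral_hasDerivAt_right (hz.continuous.intervalIntegrable _ _)
      (hz.continuous.stronglyMeasurableAtFilter _ _) hz.continuous.continuousAt).const_add _
  have h2 : deriv y = z := funext fun x => (hd x).deriv
  exact ⟨⟨fun x => (hd x).differentiableAt, hy, h2 ▸ hz⟩, h2⟩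

/-! ### The bracket -/

theorem acLoc_bracket {f g : ℝ → ℂ} (hf : IsRegular f) (hg : IsRegular g) :
    ACLoc (bracket f g) :=
  (hf.ac.conj.mul hg.ac_deriv).sub (hf.ac_deriv.conj.mul hg.ac)

/-- Lagrange's identity: the products of first derivatives cancel, and so do the terms in `q`
because `q` is real. -/
theorem ae_hasDerivAt_bracket (q : ℝ → ℝ) {f g : ℝ → ℂ} (hf : IsRegular f) (hg : IsRegular g) :
    ∀ᵐ x, HasDerivAt (bracket f g) (conj (tau q f x) * g x - conj (f x) * tau q g x) x := by
  filter_upwards [hf.ae_hasDerivAt_deriv, hg.ae_hasDerivAt_deriv] with x h1 h2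
  have h : HasDerivAt (bracket f g) _ x :=
    ((hf.hasDerivAt x).star.mul h2).sub (h1.star.mul (hg.hasDerivAt x))
  refine h.congr_deriv ?_
  simp only [tau, map_sub, map_neg, map_mul, Complex.conj_ofReal, ← starRingEnd_apply]
  ring

theorem InMaxDomain.integrable_green {q : ℝ → ℝ} {f g : ℝ → ℂ} (hf : InMaxDomain q f)
    (hg : InMaxDomain q g) :
    Integrable (fun x => conj (tau q f x) * g x - conj (f x) * tau q g x) volume :=
  (hf.memLp_tau.star.integrable_mul hg.memLp).sub (hf.memLp.star.integrable_mul hg.memLp_tau)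

theorem InMaxDomain.bracket_sub {q : ℝ → ℝ} {f g : ℝ → ℂ} (hf : InMaxDomain q f)
    (hg : InMaxDomain q g) (a b : ℝ) :
    ∫ x in a..b, (conj (tau q f x) * g x - conj (f x) * tau q g x) =
      bracket f g b - bracket f g a :=
  (acLoc_bracket hf.regular hg.regular).integral_eq_sub
    (hf.integrable_green hg).locallyIntegrable (ae_hasDerivAt_bracket q hf.regular hg.regular) a b

/-- The derivative of the bracket is a combination of products of `L²` functions, hence integrable,
so the bracket converges at both ends. -/
theorem InMaxDomain.exists_tendsto_bracket {q : ℝ → ℝ} {f g : ℝ → ℂ} (hf : InMaxDomain q f)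
    (hg : InMaxDomain q g) :
    ∃ u v : ℂ, Tendsto (bracket f g) atBot (𝓝 u) ∧ Tendsto (bracket f g) atTop (𝓝 v) := by
  have hi := hf.integrable_green hg
  have h1 := intervalIntegral_tendsto_integral_Ioi 0 hi.integrableOn tendsto_id
  have h2 := intervalIntegral_tendsto_integral_Iic 0 hi.integrableOn tendsto_id
  simp only [hf.bracket_sub hg, id] at h1 h2
  refine ⟨_, _, (h2.const_sub (bracket f g 0)).congr fun x => by ring,
    (h1.add_const (bracket f g 0)).congr fun x => by ring⟩

theorem InMaxDomain.integral_green {q : ℝ → ℝ} {f g : ℝ → ℂ} (hf : InMaxDomain q f)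
    (hg : InMaxDomain q g) {u v : ℂ} (hu : Tendsto (bracket f g) atBot (𝓝 u))
    (hv : Tendsto (bracket f g) atTop (𝓝 v)) :
    ∫ x, (conj (tau q f x) * g x - conj (f x) * tau q g x) = v - u := by
  have h := intervalIntegral_tendsto_integral (hf.integrable_green hg) tendsto_neg_atTop_atBot
    tendsto_id
  simp only [hf.bracket_sub hg] at h
  exact tendsto_nhds_unique h (hv.sub (hu.comp tendsto_neg_atTop_atBot))

/-! ### The boundary system -/

theorem conj_deriv_eq_of_real {w : ℝ → ℂ} (hw : Differentiable ℝ w) (h : ∀ x, (w x).im = 0)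
    (x : ℝ) : conj (deriv w x) = deriv w x := by
  have h1 : HasDerivAt (fun x => conj (w x)) (conj (deriv w x)) x := (hw x).hasDerivAt.star
  have h2 : (fun x => conj (w x)) = w := funext fun x => Complex.conj_eq_iff_im.2 (h x)
  rw [h2] at h1
  exact h1.deriv.symm

theorem IsSolution.tau_ae_zero {q : ℝ → ℝ} {w : ℝ → ℂ} (h : IsSolution q 0 w) :
    tau q w =ᵐ[volume] 0 := by
  filter_upwards [h.2] with x hx
  simpa using hx

theorem IsSolution.inMaxDomain {q : ℝ → ℝ} {w : ℝ → ℂ} (h : IsSolution q 0 w)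
    (hq_top : LimitCircleAtTop q) (hq_bot : LimitCircleAtBot q) : InMaxDomain q w := by
  refine ⟨?_, h.1, MemLp.zero.ae_eq h.tau_ae_zero.symm⟩
  obtain ⟨a, ha⟩ := hq_top 0 w h
  obtain ⟨b, hb⟩ := hq_bot 0 w h
  have hc := h.1.differentiable.continuous
  have hm : MemLp w 2 (volume.restrict (Set.Icc b a)) := by
    obtain ⟨C, hC⟩ := isCompact_Icc.exists_bound_of_continuousOn (s := Set.Icc b a) hc.continuousOn
    refine MemLp.of_bound hc.aestronglyMeasurable C ?_
    filter_upwards [ae_restrict_mem measurableSet_Icc] with x hx using hC x hx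
  have h1 := (memLp_indicator_iff_restrict measurableSet_Ioi).2 ha
  have h2 := (memLp_indicator_iff_restrict measurableSet_Iio).2 hb
  have h3 := (memLp_indicator_iff_restrict measurableSet_Icc).2 hm
  -- The three pieces cover the line but may overlap, hence a bound by the sum of their norms
  -- instead of a decomposition.
  refine ((h1.norm.add h2.norm).add h3.norm).mono' hc.aestronglyMeasurable (ae_of_all _ fun x => ?_)
  simp only [Pi.add_apply, Set.indicator_apply, Set.mem_Ioi, Set.mem_Iio, Set.mem_Icc]
  have := norm_nonneg (w x)
  rcases lt_or_ge a x with h4 | h4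
  · rw [if_pos h4]
    linarith [norm_nonneg (if x < b then w x else 0),
      norm_nonneg (if b ≤ x ∧ x ≤ a then w x else 0)]
  · rcases lt_or_ge x b with h5 | h5
    · rw [if_pos h5]
      linarith [norm_nonneg (if a < x then w x else 0),
        norm_nonneg (if b ≤ x ∧ x ≤ a then w x else 0)]
    · rw [if_pos (show b ≤ x ∧ x ≤ a from ⟨h5, h4⟩)]
      linarith [norm_nonneg (if a < x then w x else 0),
        norm_nonneg (if x < b then w x else 0)]

/-- The standard symplectic sesquilinear form on `ℂ²`. -/
def symp (u v : Fin 2 → ℂ) : ℂ := conj (u 0) * v 1 - conj (u 1) * v 0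

theorem HasBoundaryValues.unique {w₁ w₂ y : ℝ → ℂ} {α β α' β' : Fin 2 → ℂ}
    (h : HasBoundaryValues w₁ w₂ y α β) (h' : HasBoundaryValues w₁ w₂ y α' β') :
    α = α' ∧ β = β' := by
  constructor <;> funext i <;> fin_cases i
  exacts [tendsto_nhds_unique h.alpha₁ h'.alpha₁, tendsto_nhds_unique h.alpha₂ h'.alpha₂,
    tendsto_nhds_unique h.beta₁ h'.beta₁, tendsto_nhds_unique h.beta₂ h'.beta₂]

namespace IsBoundarySystem

variable {q : ℝ → ℝ} {w₁ w₂ : ℝ → ℂ}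

theorem conj₁ (hw : IsBoundarySystem q w₁ w₂) (x : ℝ) : conj (w₁ x) = w₁ x :=
  Complex.conj_eq_iff_im.2 (hw.real₁ x)

theorem conj₂ (hw : IsBoundarySystem q w₁ w₂) (x : ℝ) : conj (w₂ x) = w₂ x :=
  Complex.conj_eq_iff_im.2 (hw.real₂ x)

theorem conj_deriv₁ (hw : IsBoundarySystem q w₁ w₂) (x : ℝ) : conj (deriv w₁ x) = deriv w₁ x :=
  conj_deriv_eq_of_real hw.sol₁.1.differentiable hw.real₁ x

theorem conj_deriv₂ (hw : IsBoundarySystem q w₁ w₂) (x : ℝ) : conj (deriv w₂ x) = deriv w₂ x :=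
  conj_deriv_eq_of_real hw.sol₂.1.differentiable hw.real₂ x

/-- Both functions solve `τ = 0`, so the bracket has zero derivative almost everywhere and equals
its limit 1. -/
theorem wronskian (hw : IsBoundarySystem q w₁ w₂) (x : ℝ) :
    w₁ x * deriv w₂ x - deriv w₁ x * w₂ x = 1 := by
  have hc : ∀ x, bracket w₁ w₂ x = bracket w₁ w₂ 0 := by
    intro x
    have hd : ∀ᵐ x, HasDerivAt (bracket w₁ w₂) ((fun _ => (0 : ℂ)) x) x := by
      filter_upwards [ae_hasDerivAt_bracket q hw.sol₁.1 hw.sol₂.1, hw.sol₁.tau_ae_zero,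
        hw.sol₂.tau_ae_zero] with x h h1 h2
      simpa [h1, h2] using h
    have := (acLoc_bracket hw.sol₁.1 hw.sol₂.1).integral_eq_sub
      (continuous_const.locallyIntegrable) hd 0 x
    rw [intervalIntegral.integral_zero] at this
    exact (sub_eq_zero.1 this.symm)
  have h1 : bracket w₁ w₂ x = 1 := by
    refine tendsto_nhds_unique ?_ hw.bracket_top
    rw [show bracket w₁ w₂ = fun _ => bracket w₁ w₂ x from
      funext fun y => (hc y).trans (hc x).symm]
    exact tendsto_const_nhds
  rwa [bracket, hw.conj₁, hw.conj_deriv₁] at h1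

theorem bracket₁ (hw : IsBoundarySystem q w₁ w₂) (y : ℝ → ℂ) (x : ℝ) :
    bracket w₁ y x = w₁ x * deriv y x - deriv w₁ x * y x := by
  rw [bracket, hw.conj₁, hw.conj_deriv₁]

theorem bracket₂ (hw : IsBoundarySystem q w₁ w₂) (y : ℝ → ℂ) (x : ℝ) :
    bracket w₂ y x = w₂ x * deriv y x - deriv w₂ x * y x := by
  rw [bracket, hw.conj₂, hw.conj_deriv₂]

/-- The Plücker identity. -/
theorem bracket_eq_symp (hw : IsBoundarySystem q w₁ w₂) (f g : ℝ → ℂ) (x : ℝ) :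
    bracket f g x = conj (bracket w₁ f x) * bracket w₂ g x -
      conj (bracket w₂ f x) * bracket w₁ g x := by
  simp only [hw.bracket₁, hw.bracket₂, map_sub, map_mul, hw.conj₁, hw.conj₂, hw.conj_deriv₁,
    hw.conj_deriv₂]
  rw [bracket]
  linear_combination (conj (deriv f x) * g x - conj (f x) * deriv g x) * hw.wronskian x

theorem hasBoundaryValues₁ (hw : IsBoundarySystem q w₁ w₂) :
    HasBoundaryValues w₁ w₂ w₁ ![0, -1] ![0, -1] := by
  have h1 : bracket w₁ w₁ = fun _ => 0 := funext fun x => by rw [hw.bracket₁]; ring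
  have h2 : bracket w₂ w₁ = fun _ => -1 := funext fun x => by
    rw [hw.bracket₂]; linear_combination -hw.wronskian x
  constructor <;> simp only [h1, h2] <;> exact tendsto_const_nhds

theorem hasBoundaryValues₂ (hw : IsBoundarySystem q w₁ w₂) :
    HasBoundaryValues w₁ w₂ w₂ ![1, 0] ![1, 0] := by
  have h1 : bracket w₁ w₂ = fun _ => 1 := funext fun x => by rw [hw.bracket₁, hw.wronskian]
  have h2 : bracket w₂ w₂ = fun _ => 0 := funext fun x => by rw [hw.bracket₂]; ring
  constructor <;> simp only [h1, h2] <;> exact tendsto_const_nhds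

theorem tendsto_bracket_bot (hw : IsBoundarySystem q w₁ w₂) {f g : ℝ → ℂ}
    {α β α' β' : Fin 2 → ℂ} (hf : HasBoundaryValues w₁ w₂ f α β)
    (hg : HasBoundaryValues w₁ w₂ g α' β') : Tendsto (bracket f g) atBot (𝓝 (symp α α')) := by
  simp only [funext (hw.bracket_eq_symp f g)]
  exact (hf.alpha₁.star.mul hg.alpha₂).sub (hf.alpha₂.star.mul hg.alpha₁)

theorem tendsto_bracket_top (hw : IsBoundarySystem q w₁ w₂) {f g : ℝ → ℂ}
    {α β α' β' : Fin 2 → ℂ} (hf : HasBoundaryValues w₁ w₂ f α β)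
    (hg : HasBoundaryValues w₁ w₂ g α' β') : Tendsto (bracket f g) atTop (𝓝 (symp β β')) := by
  simp only [funext (hw.bracket_eq_symp f g)]
  exact (hf.beta₁.star.mul hg.beta₂).sub (hf.beta₂.star.mul hg.beta₁)

/-- Green's formula. -/
theorem integral_green (hw : IsBoundarySystem q w₁ w₂) {f g : ℝ → ℂ} {α β α' β' : Fin 2 → ℂ}
    (hf : InMaxDomain q f) (hg : InMaxDomain q g) (hf' : HasBoundaryValues w₁ w₂ f α β)
    (hg' : HasBoundaryValues w₁ w₂ g α' β') :
    ∫ x, (conj (tau q f x) * g x - conj (f x) * tau q g x) = symp β β' - symp α α' :=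
  hf.integral_green hg (hw.tendsto_bracket_bot hf' hg') (hw.tendsto_bracket_top hf' hg')

theorem exists_boundaryValues (h₁ : InMaxDomain q w₁) (h₂ : InMaxDomain q w₂) {f : ℝ → ℂ}
    (hf : InMaxDomain q f) : ∃ α β, HasBoundaryValues w₁ w₂ f α β := by
  obtain ⟨u, v, h1, h2⟩ := h₁.exists_tendsto_bracket hf
  obtain ⟨u', v', h1', h2'⟩ := h₂.exists_tendsto_bracket hf
  exact ⟨![u, u'], ![v, v'], h1, h1', h2, h2'⟩

/-- Variation of constants. -/
theorem exists_tau_eq (hw : IsBoundarySystem q w₁ w₂) (h₁ : InMaxDomain q w₁)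
    (h₂ : InMaxDomain q w₂) {h : ℝ → ℂ} (hh : MemLp h 2 volume) :
    ∃ y, InMaxDomain q y ∧ tau q y =ᵐ[volume] h := by
  have hi₁ : Integrable (fun x => w₁ x * h x) volume := h₁.memLp.integrable_mul hh
  have hi₂ : Integrable (fun x => w₂ x * h x) volume := h₂.memLp.integrable_mul hh
  set B₁ : ℝ → ℂ := fun x => ∫ t in (0 : ℝ)..x, w₁ t * h t with hB₁
  set B₂ : ℝ → ℂ := fun x => ∫ t in (0 : ℝ)..x, w₂ t * h t with hB₂
  have hac₁ : ACLoc B₁ := acLoc_integral hi₁.locallyIntegrable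
  have hac₂ : ACLoc B₂ := acLoc_integral hi₂.locallyIntegrable
  have hd₁ : ∀ᵐ x, HasDerivAt B₁ (w₁ x * h x) x := by
    filter_upwards [LocallyIntegrable.ae_hasDerivAt_integral hi₁.locallyIntegrable] with x hx
      using hx 0
  have hd₂ : ∀ᵐ x, HasDerivAt B₂ (w₂ x * h x) x := by
    filter_upwards [LocallyIntegrable.ae_hasDerivAt_integral hi₂.locallyIntegrable] with x hx
      using hx 0
  -- `z` is the derivative of `y`: the terms containing `B₁'` and `B₂'` cancel.
  set y : ℝ → ℂ := fun x => w₁ x * B₂ x - w₂ x * B₁ x with hy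
  set z : ℝ → ℂ := fun x => deriv w₁ x * B₂ x - deriv w₂ x * B₁ x with hz
  have hyac : ACLoc y := (h₁.regular.ac.mul hac₂).sub (h₂.regular.ac.mul hac₁)
  have hzac : ACLoc z := (h₁.regular.ac_deriv.mul hac₂).sub (h₂.regular.ac_deriv.mul hac₁)
  obtain ⟨hreg, hder⟩ := IsRegular.of_ae_hasDerivAt hyac hzac (by
    filter_upwards [hd₁, hd₂] with x e1 e2
    refine HasDerivAt.congr_deriv (((h₁.regular.hasDerivAt x).fun_mul e2).fun_sub
      ((h₂.regular.hasDerivAt x).fun_mul e1)) ?_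
    simp only [hz]
    ring)
  have htau : tau q y =ᵐ[volume] h := by
    filter_upwards [hd₁, hd₂, h₁.regular.ae_hasDerivAt_deriv, h₂.regular.ae_hasDerivAt_deriv,
      hw.sol₁.tau_ae_zero, hw.sol₂.tau_ae_zero] with x e1 e2 e3 e4 e5 e6
    have e7 : deriv z x = _ := ((e3.fun_mul e2).fun_sub (e4.fun_mul e1)).deriv
    simp only [tau, Pi.zero_apply] at e5 e6 ⊢
    rw [hder, e7]
    simp only [hy]
    linear_combination h x * hw.wronskian x + B₂ x * e5 - B₁ x * e6
  -- Square integrability of `w₁`, `w₂` makes `w₁ h`, `w₂ h` integrable, so `B₁`, `B₂` are bounded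
  -- and `y` inherits `L²` from `w₁`, `w₂`.
  have hb : ∀ {w : ℝ → ℂ}, Integrable (fun x => w x * h x) volume → ∀ x,
      ‖∫ t in (0 : ℝ)..x, w t * h t‖ ≤ ∫ t, ‖w t * h t‖ := fun hi x =>
    intervalIntegral.norm_integral_le_integral_norm_uIoc.trans
      (setIntegral_le_integral hi.norm (ae_of_all _ fun _ => norm_nonneg _))
  have hm : ∀ {w B : ℝ → ℂ} {C : ℝ}, MemLp w 2 volume → Continuous B → (∀ x, ‖B x‖ ≤ C) →
      MemLp (fun x => w x * B x) 2 volume := by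
    intro w B C hw hB hC
    refine MemLp.of_le_mul (c := C) hw (hw.1.mul hB.aestronglyMeasurable) (ae_of_all _ fun x => ?_)
    rw [norm_mul, mul_comm]
    exact mul_le_mul_of_nonneg_right (hC x) (norm_nonneg _)
  exact ⟨y, ⟨(hm h₁.memLp hac₂.continuous (hb hi₂)).sub (hm h₂.memLp hac₁.continuous (hb hi₁)),
    hreg, hh.ae_eq htau.symm⟩, htau⟩

/-- Adding a combination of `w₁` and `w₂` leaves `τ y` unchanged and shifts `α` arbitrarily, since
their values at `-∞` are `(0, -1)` and `(1, 0)`. -/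
theorem exists_tau_eq_of_alpha (hw : IsBoundarySystem q w₁ w₂) (h₁ : InMaxDomain q w₁)
    (h₂ : InMaxDomain q w₂) {h : ℝ → ℂ} (hh : MemLp h 2 volume) (α : Fin 2 → ℂ) :
    ∃ y β, InMaxDomain q y ∧ tau q y =ᵐ[volume] h ∧ HasBoundaryValues w₁ w₂ y α β := by
  obtain ⟨y, hy, hτ⟩ := hw.exists_tau_eq h₁ h₂ hh
  obtain ⟨α', β', hb⟩ := exists_boundaryValues h₁ h₂ hy
  have e1 : InMaxDomain q ((α' 1 - α 1) • w₁ + (α 0 - α' 0) • w₂) := (h₁.smul _).add (h₂.smul _)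
  have e2 := (hw.hasBoundaryValues₁.smul (α' 1 - α 1) h₁.regular).add (h₁.smul _).regular
    (h₂.smul _).regular (hw.hasBoundaryValues₂.smul (α 0 - α' 0) h₂.regular)
  have e3 : α' + ((α' 1 - α 1) • ![0, -1] + (α 0 - α' 0) • ![1, 0]) = α := by
    funext i
    fin_cases i <;> simp
  refine ⟨_, _, hy.add e1, ?_, e3 ▸ hb.add hy.regular e1.regular e2⟩
  filter_upwards [tau_add_ae q hy.regular e1.regular, hτ,
    tau_add_ae q (h₁.smul (α' 1 - α 1)).regular (h₂.smul (α 0 - α' 0)).regular,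
    tau_smul_ae q (α' 1 - α 1) h₁.regular, tau_smul_ae q (α 0 - α' 0) h₂.regular,
    hw.sol₁.tau_ae_zero, hw.sol₂.tau_ae_zero] with x a1 a2 a3 a4 a5 a6 a7
  rw [a1, Pi.add_apply, a2, a3, Pi.add_apply, a4, a5]
  simp [a6, a7]

/-- The boundary values at `±∞` differ by the moments of `τ_q y` against `w₁`, `w₂`. -/
theorem beta_sub_alpha (hw : IsBoundarySystem q w₁ w₂) (h₁ : InMaxDomain q w₁)
    (h₂ : InMaxDomain q w₂) {y h : ℝ → ℂ} (hy : InMaxDomain q y) (hτ : tau q y =ᵐ[volume] h)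
    {α β : Fin 2 → ℂ} (hb : HasBoundaryValues w₁ w₂ y α β) :
    (∫ x, w₁ x * h x) = α 0 - β 0 ∧ (∫ x, w₂ x * h x) = α 1 - β 1 := by
  have e1 := hw.integral_green h₁ hy hw.hasBoundaryValues₁ hb
  have e2 := hw.integral_green h₂ hy hw.hasBoundaryValues₂ hb
  have i1 : ∫ x, (conj (tau q w₁ x) * y x - conj (w₁ x) * tau q y x) = ∫ x, -(w₁ x * h x) := by
    refine integral_congr_ae ?_
    filter_upwards [hw.sol₁.tau_ae_zero, hτ] with x a1 a2
    rw [a1, a2, hw.conj₁]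
    simp
  have i2 : ∫ x, (conj (tau q w₂ x) * y x - conj (w₂ x) * tau q y x) = ∫ x, -(w₂ x * h x) := by
    refine integral_congr_ae ?_
    filter_upwards [hw.sol₂.tau_ae_zero, hτ] with x a1 a2
    rw [a1, a2, hw.conj₂]
    simp
  rw [i1, integral_neg] at e1
  rw [i2, integral_neg] at e2
  simp [symp] at e1 e2
  constructor
  · linear_combination -e1
  · linear_combination -e2

/-- The integrand is odd. Thus the Gram matrix of `w₁`, `w₂` is diagonal. -/
theorem integral_mul_eq_zero (hw : IsBoundarySystem q w₁ w₂) : ∫ x, w₁ x * w₂ x = 0 := by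
  have h := integral_neg_eq_self (fun x => w₁ x * w₂ x) volume
  simp only [hw.odd₁ _, hw.even₂ _, neg_mul, integral_neg] at h
  exact self_eq_neg.1 h.symm

theorem integral_sq_ne_zero {w : ℝ → ℂ} (hc : Continuous w) (hm : MemLp w 2 volume)
    (hr : ∀ x, (w x).im = 0) {x₀ : ℝ} (hx : w x₀ ≠ 0) : ∫ x, w x * w x ≠ 0 := by
  have e : ∀ x, w x * w x = ((‖w x‖ ^ 2 : ℝ) : ℂ) := by
    intro x
    rw [← Complex.normSq_eq_norm_sq, ← Complex.mul_conj, Complex.conj_eq_iff_im.2 (hr x)]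
  simp only [e]
  rw [show ∫ x, ((‖w x‖ ^ 2 : ℝ) : ℂ) = ((∫ x, ‖w x‖ ^ 2 : ℝ) : ℂ) from integral_ofReal]
  refine Complex.ofReal_ne_zero.2 (ne_of_gt ?_)
  exact integral_pos_of_integrable_nonneg_nonzero (x := x₀) (by fun_prop) ((memLp_two_iff_integrable_sq_norm hm.1).1 hm)
    (fun x => by positivity) (by simpa using hx)

/-- Every pair of boundary values is attained. -/
theorem exists_hasBoundaryValues (hw : IsBoundarySystem q w₁ w₂) (h₁ : InMaxDomain q w₁)
    (h₂ : InMaxDomain q w₂) (α β : Fin 2 → ℂ) :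
    ∃ y, InMaxDomain q y ∧ HasBoundaryValues w₁ w₂ y α β := by
  have n₁ : ∫ x, w₁ x * w₁ x ≠ 0 := by
    have : ∃ x, w₁ x ≠ 0 := by
      by_contra! h
      have := hw.wronskian 0
      rw [show w₁ = fun _ => 0 from funext h] at this
      simp at this
    exact integral_sq_ne_zero h₁.regular.differentiable.continuous h₁.memLp hw.real₁ this.choose_spec
  have n₂ : ∫ x, w₂ x * w₂ x ≠ 0 := by
    have : ∃ x, w₂ x ≠ 0 := by
      by_contra! h
      have := hw.wronskian 0
      rw [show w₂ = fun _ => 0 from funext h] at this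
      simp at this
    exact integral_sq_ne_zero h₂.regular.differentiable.continuous h₂.memLp hw.real₂ this.choose_spec
  -- With source `c₁ w₁ + c₂ w₂` the moments must be `α - β`; the Gram matrix being diagonal, each
  -- coefficient is a quotient.
  set c₁ := (α 0 - β 0) / ∫ x, w₁ x * w₁ x with hc₁
  set c₂ := (α 1 - β 1) / ∫ x, w₂ x * w₂ x with hc₂
  obtain ⟨y, β', hy, hτ, hb⟩ := hw.exists_tau_eq_of_alpha h₁ h₂
    ((h₁.memLp.const_smul c₁).add (h₂.memLp.const_smul c₂)) α
  obtain ⟨e1, e2⟩ := hw.beta_sub_alpha h₁ h₂ hy hτ hb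
  have i11 : Integrable (fun x => w₁ x * w₁ x) volume := h₁.memLp.integrable_mul h₁.memLp
  have i12 : Integrable (fun x => w₁ x * w₂ x) volume := h₁.memLp.integrable_mul h₂.memLp
  have i22 : Integrable (fun x => w₂ x * w₂ x) volume := h₂.memLp.integrable_mul h₂.memLp
  have f1 : ∫ x, w₁ x * (c₁ • w₁ + c₂ • w₂) x = α 0 - β 0 := by
    have : ∀ x, w₁ x * (c₁ • w₁ + c₂ • w₂) x = c₁ * (w₁ x * w₁ x) + c₂ * (w₁ x * w₂ x) := by
      intro x
      simp only [Pi.add_apply, Pi.smul_apply, smul_eq_mul]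
      ring
    simp only [this]
    rw [integral_add (i11.const_mul _) (i12.const_mul _), integral_const_mul, integral_const_mul,
      hw.integral_mul_eq_zero, hc₁, div_mul_cancel₀ _ n₁]
    ring
  have f2 : ∫ x, w₂ x * (c₁ • w₁ + c₂ • w₂) x = α 1 - β 1 := by
    have : ∀ x, w₂ x * (c₁ • w₁ + c₂ • w₂) x = c₁ * (w₁ x * w₂ x) + c₂ * (w₂ x * w₂ x) := by
      intro x
      simp only [Pi.add_apply, Pi.smul_apply, smul_eq_mul]
      ring
    simp only [this]
    rw [integral_add (i12.const_mul _) (i22.const_mul _), integral_const_mul, integral_const_mul,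
      hw.integral_mul_eq_zero, hc₂, div_mul_cancel₀ _ n₂]
    ring
  have : β' = β := by
    funext i
    fin_cases i
    · exact sub_right_injective (e1.symm.trans f1)
    · exact sub_right_injective (e2.symm.trans f2)
  exact ⟨y, hy, this ▸ hb⟩

end IsBoundarySystem

/-! ### Restrictions of the maximal operator by boundary relations -/

theorem symp_add_right (u v v' : Fin 2 → ℂ) : symp u (v + v') = symp u v + symp u v' := by
  simp only [symp, Pi.add_apply]; ring

theorem symp_smul_right (c : ℂ) (u v : Fin 2 → ℂ) : symp u (c • v) = c * symp u v := by
  simp only [symp, Pi.smul_apply, smul_eq_mul]; ring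

theorem symp_zero_right (u : Fin 2 → ℂ) : symp u 0 = 0 := by simp [symp]

theorem symp_zero_left (u : Fin 2 → ℂ) : symp 0 u = 0 := by simp [symp]

/-- The orthogonal complement of a boundary relation for the boundary form
`symp β β' - symp α α'`. -/
def orth (S : Submodule ℂ ((Fin 2 → ℂ) × (Fin 2 → ℂ))) :
    Submodule ℂ ((Fin 2 → ℂ) × (Fin 2 → ℂ)) where
  carrier := {p | ∀ s ∈ S, symp s.2 p.2 = symp s.1 p.1}
  zero_mem' := fun s _ => by simp only [Prod.fst_zero, Prod.snd_zero, symp_zero_right]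
  add_mem' := fun hp hp' s hs => by
    simp only [Prod.fst_add, Prod.snd_add, symp_add_right, hp s hs, hp' s hs]
  smul_mem' := fun c p hp s hs => by
    simp only [Prod.smul_fst, Prod.smul_snd, symp_smul_right, hp s hs]

/-- The restriction of the maximal operator to the functions whose boundary values lie in `S`. -/
def relOp (q : ℝ → ℝ) (w₁ w₂ : ℝ → ℂ) (S : Submodule ℂ ((Fin 2 → ℂ) × (Fin 2 → ℂ))) :
    L2R →ₗ.[ℂ] L2R :=
  (maxOp q).domRestrict (boundaryDomain q w₁ w₂ S)

/-- Frees later arguments from the chosen representative `rep`: a regular representative is unique.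
-/
theorem mem_graph_relOp {q : ℝ → ℝ} {w₁ w₂ : ℝ → ℂ}
    {S : Submodule ℂ ((Fin 2 → ℂ) × (Fin 2 → ℂ))} {f k : L2R} :
    (f, k) ∈ (relOp q w₁ w₂ S).graph ↔ ∃ y, InMaxDomain q y ∧ f =ᵐ[volume] y ∧
      k =ᵐ[volume] tau q y ∧ ∃ α β, HasBoundaryValues w₁ w₂ y α β ∧ (α, β) ∈ S := by
  rw [LinearPMap.mem_graph_iff]
  constructor
  · rintro ⟨⟨f', hf'⟩, h1, h2⟩
    obtain rfl : f' = f := h1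
    obtain ⟨y, hy, hfy, hS⟩ := hf'.1
    refine ⟨y, hy, hfy, ?_, hS⟩
    have e : relOp q w₁ w₂ S ⟨f', hf'⟩ = maxOp q ⟨f', hf'.2⟩ := LinearPMap.domRestrict_apply rfl
    obtain rfl : _ = k := h2
    rw [e, ← rep_eq ⟨f', hf'.2⟩ hy.regular hfy]
    exact MemLp.coeFn_toLp (rep_inMaxDomain ⟨f', hf'.2⟩).memLp_tau
  · rintro ⟨y, hy, hfy, hky, hS⟩
    have hm : f ∈ maxDomain q := ⟨y, hy, hfy⟩
    refine ⟨⟨f, ⟨y, hy, hfy, hS⟩, hm⟩, rfl, ?_⟩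
    have e : relOp q w₁ w₂ S ⟨f, ⟨y, hy, hfy, hS⟩, hm⟩ = maxOp q ⟨f, hm⟩ :=
      LinearPMap.domRestrict_apply rfl
    rw [e]
    apply Lp.ext
    refine (MemLp.coeFn_toLp (rep_inMaxDomain ⟨f, hm⟩).memLp_tau).trans ?_
    rw [rep_eq ⟨f, hm⟩ hy.regular hfy]
    exact hky.symm

theorem inner_eq_integral {f g : L2R} {y z : ℝ → ℂ} (hf : f =ᵐ[volume] y)
    (hg : g =ᵐ[volume] z) : inner ℂ f g = ∫ x, conj (y x) * z x := by
  rw [L2.inner_def]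
  refine integral_congr_ae ?_
  filter_upwards [hf, hg] with x h1 h2
  rw [h1, h2, RCLike.inner_apply, mul_comm]

theorem inner_sub_inner_eq {q : ℝ → ℝ} {y z : ℝ → ℂ} (hy : InMaxDomain q y)
    (hz : InMaxDomain q z) {f k g l : L2R} (hf : f =ᵐ[volume] y) (hk : k =ᵐ[volume] tau q y)
    (hg : g =ᵐ[volume] z) (hl : l =ᵐ[volume] tau q z) :
    inner ℂ k g - inner ℂ f l = ∫ x, (conj (tau q y x) * z x - conj (y x) * tau q z x) := by
  rw [inner_eq_integral hk hg, inner_eq_integral hf hl, integral_sub]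
  · exact hy.memLp_tau.star.integrable_mul hz.memLp
  · exact hy.memLp.star.integrable_mul hz.memLp_tau

/-! ### Density, adjoint and closedness of the restrictions. -/

namespace IsBoundarySystem

variable {q : ℝ → ℝ} {w₁ w₂ : ℝ → ℂ}

/-- The adjoint of the minimal operator is contained in the maximal operator. -/
theorem exists_of_inner_eq (hw : IsBoundarySystem q w₁ w₂) (h₁ : InMaxDomain q w₁)
    (h₂ : InMaxDomain q w₂) {g l : L2R}
    (H : ∀ y (hy : InMaxDomain q y), HasBoundaryValues w₁ w₂ y 0 0 →
      inner ℂ (hy.memLp_tau.toLp (tau q y)) g - inner ℂ (hy.memLp.toLp y) l = 0) :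
    ∃ z, InMaxDomain q z ∧ g =ᵐ[volume] z ∧ l =ᵐ[volume] tau q z := by
  obtain ⟨z₀, hz₀, hτ⟩ := hw.exists_tau_eq h₁ h₂ (Lp.memLp l)
  obtain ⟨α, β, hb⟩ := exists_boundaryValues h₁ h₂ hz₀
  set W₁ : L2R := h₁.memLp.toLp w₁
  set W₂ : L2R := h₂.memLp.toLp w₂
  -- Any `h` orthogonal to `w₁`, `w₂` is `τ y` with `α = 0`, and its vanishing moments give `β = 0`
  -- too. So `H` applies to `y`, and comparison with Green's formula for `z₀` shows `g - z₀`
  -- orthogonal to `h`.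
  have key : g - hz₀.memLp.toLp z₀ ∈ (Submodule.span ℂ {W₁, W₂})ᗮᗮ := by
    rw [Submodule.mem_orthogonal]
    intro h hh
    rw [Submodule.mem_orthogonal] at hh
    have e1 := hh W₁ (Submodule.subset_span (by simp))
    have e2 := hh W₂ (Submodule.subset_span (by simp))
    rw [inner_eq_integral (MemLp.coeFn_toLp _) (EventuallyEq.refl _ _)] at e1 e2
    simp only [hw.conj₁, hw.conj₂] at e1 e2
    obtain ⟨y, β', hy, hyτ, hyb⟩ := hw.exists_tau_eq_of_alpha h₁ h₂ (Lp.memLp h) 0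
    obtain ⟨a1, a2⟩ := hw.beta_sub_alpha h₁ h₂ hy hyτ hyb
    have hβ : β' = 0 := by
      funext i
      fin_cases i
      · simpa [e1] using a1
      · simpa [e2] using a2
    subst hβ
    have b1 := H y hy hyb
    have b2 := inner_sub_inner_eq hy hz₀ hy.memLp.coeFn_toLp hy.memLp_tau.coeFn_toLp
      hz₀.memLp.coeFn_toLp hτ.symm
    rw [hw.integral_green hy hz₀ hyb hb, symp_zero_left, symp_zero_left, sub_zero] at b2
    have b3 : hy.memLp_tau.toLp (tau q y) = h := Lp.ext (hy.memLp_tau.coeFn_toLp.trans hyτ)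
    rw [b3] at b1 b2
    rw [inner_sub_right]
    linear_combination b1 - b2
  -- A finite-dimensional span is its own double orthogonal complement, so `g - z₀` is a combination
  -- of `w₁`, `w₂`, on which `τ` vanishes.
  have : FiniteDimensional ℂ (Submodule.span ℂ {W₁, W₂}) :=
    FiniteDimensional.span_of_finite ℂ (Set.toFinite _)
  rw [Submodule.orthogonal_orthogonal, Submodule.mem_span_pair] at key
  obtain ⟨c₁, c₂, hc⟩ := key
  have e1 : InMaxDomain q (c₁ • w₁ + c₂ • w₂) := (h₁.smul _).add (h₂.smul _)
  refine ⟨c₁ • w₁ + c₂ • w₂ + z₀, e1.add hz₀, ?_, ?_⟩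
  · have : g = c₁ • W₁ + c₂ • W₂ + hz₀.memLp.toLp z₀ := by rw [hc, sub_add_cancel]
    rw [this]
    exact (Lp.coeFn_add _ _).trans (((Lp.coeFn_add _ _).trans
      (((Lp.coeFn_smul _ _).trans (h₁.memLp.coeFn_toLp.const_smul c₁)).add
        ((Lp.coeFn_smul _ _).trans (h₂.memLp.coeFn_toLp.const_smul c₂)))).add
        hz₀.memLp.coeFn_toLp)
  · filter_upwards [tau_add_ae q e1.regular hz₀.regular, hτ,
      tau_add_ae q (h₁.smul c₁).regular (h₂.smul c₂).regular,
      tau_smul_ae q c₁ h₁.regular, tau_smul_ae q c₂ h₂.regular,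
      hw.sol₁.tau_ae_zero, hw.sol₂.tau_ae_zero] with x a1 a2 a3 a4 a5 a6 a7
    rw [a1, Pi.add_apply, a2, a3, Pi.add_apply, a4, a5]
    simp [a6, a7]

theorem mem_graph_of_zero {y : ℝ → ℂ} (hy : InMaxDomain q y)
    (hb : HasBoundaryValues w₁ w₂ y 0 0) (S : Submodule ℂ ((Fin 2 → ℂ) × (Fin 2 → ℂ))) :
    (hy.memLp.toLp y, hy.memLp_tau.toLp (tau q y)) ∈ (relOp q w₁ w₂ S).graph :=
  mem_graph_relOp.2 ⟨y, hy, hy.memLp.coeFn_toLp, hy.memLp_tau.coeFn_toLp, 0, 0, hb, S.zero_mem⟩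

/-- If `l` is orthogonal to the domain, then `(0, l)` satisfies the adjoint relation, so `l = τ 0 =
0`. -/
theorem dense_domain (hw : IsBoundarySystem q w₁ w₂) (h₁ : InMaxDomain q w₁)
    (h₂ : InMaxDomain q w₂) (S : Submodule ℂ ((Fin 2 → ℂ) × (Fin 2 → ℂ))) :
    Dense ((relOp q w₁ w₂ S).domain : Set L2R) := by
  rw [Submodule.dense_iff_topologicalClosure_eq_top, Submodule.topologicalClosure_eq_top_iff,
    Submodule.eq_bot_iff]
  intro l hl
  obtain ⟨z, hz, hz0, hzl⟩ := hw.exists_of_inner_eq h₁ h₂ (g := 0) (l := l) fun y hy hb => by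
    have h := LinearPMap.mem_domain_of_mem_graph (mem_graph_of_zero hy hb S)
    rw [inner_zero_right, (Submodule.mem_orthogonal _ _).1 hl _ h, sub_zero]
  have e : z = 0 := hz.regular.eq_of_ae (InMaxDomain.zero q).regular
    (hz0.symm.trans (Lp.coeFn_zero _ _ _))
  subst e
  refine Lp.ext (hzl.trans (EventuallyEq.trans ?_ (Lp.coeFn_zero _ _ _).symm))
  simpa using tau_smul_ae q 0 (InMaxDomain.zero q).regular

/-- Testing against functions with zero boundary values puts an element of the adjoint graph in the
maximal operator. Green's formula then leaves only the boundary form, and all of `S` is tested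
because every boundary value is attained. -/
theorem adjoint_relOp (hw : IsBoundarySystem q w₁ w₂) (h₁ : InMaxDomain q w₁)
    (h₂ : InMaxDomain q w₂) (S : Submodule ℂ ((Fin 2 → ℂ) × (Fin 2 → ℂ))) :
    (relOp q w₁ w₂ S).adjoint = relOp q w₁ w₂ (orth S) := by
  apply LinearPMap.eq_of_eq_graph
  rw [LinearPMap.adjoint_graph_eq_graph_adjoint (hw.dense_domain h₁ h₂ S)]
  ext ⟨g, l⟩
  rw [Submodule.mem_adjoint_iff, mem_graph_relOp]
  constructor
  · intro H
    obtain ⟨z, hz, hgz, hlz⟩ := hw.exists_of_inner_eq h₁ h₂ fun y hy hb =>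
      H _ _ (mem_graph_of_zero hy hb S)
    obtain ⟨α', β', hb⟩ := exists_boundaryValues h₁ h₂ hz
    refine ⟨z, hz, hgz, hlz, α', β', hb, ?_⟩
    rintro ⟨α, β⟩ hs
    obtain ⟨y, hy, hyb⟩ := hw.exists_hasBoundaryValues h₁ h₂ α β
    have e1 := H _ _ (mem_graph_relOp.2 ⟨y, hy, hy.memLp.coeFn_toLp, hy.memLp_tau.coeFn_toLp,
      α, β, hyb, hs⟩)
    rw [inner_sub_inner_eq hy hz hy.memLp.coeFn_toLp hy.memLp_tau.coeFn_toLp hgz hlz,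
      hw.integral_green hy hz hyb hb] at e1
    exact sub_eq_zero.1 e1
  · rintro ⟨z, hz, hgz, hlz, α', β', hb, hS⟩ f k hfk
    obtain ⟨y, hy, hfy, hky, α, β, hyb, hs⟩ := mem_graph_relOp.1 hfk
    rw [inner_sub_inner_eq hy hz hfy hky hgz hlz, hw.integral_green hy hz hyb hb]
    exact sub_eq_zero.2 (hS _ hs)

/-- Membership in the graph, once the boundary values are known. -/
theorem mem_graph_iff {y : ℝ → ℂ} (hy : InMaxDomain q y) {α β : Fin 2 → ℂ}
    (hb : HasBoundaryValues w₁ w₂ y α β) {S : Submodule ℂ ((Fin 2 → ℂ) × (Fin 2 → ℂ))} {f k : L2R}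
    (hf : f =ᵐ[volume] y) (hk : k =ᵐ[volume] tau q y) :
    (f, k) ∈ (relOp q w₁ w₂ S).graph ↔ (α, β) ∈ S := by
  rw [mem_graph_relOp]
  constructor
  · rintro ⟨y', hy', hf', -, α', β', hb', hS⟩
    obtain rfl := hy.regular.eq_of_ae hy'.regular (hf.symm.trans hf')
    obtain ⟨rfl, rfl⟩ := hb.unique hb'
    exact hS
  · exact fun h => ⟨y, hy, hf, hk, α, β, hb, h⟩

theorem relOp_injective (hw : IsBoundarySystem q w₁ w₂) (h₁ : InMaxDomain q w₁)
    (h₂ : InMaxDomain q w₂) {S S' : Submodule ℂ ((Fin 2 → ℂ) × (Fin 2 → ℂ))} :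
    relOp q w₁ w₂ S = relOp q w₁ w₂ S' ↔ S = S' := by
  refine ⟨fun h => ?_, fun h => h ▸ rfl⟩
  ext ⟨α, β⟩
  obtain ⟨y, hy, hb⟩ := hw.exists_hasBoundaryValues h₁ h₂ α β
  rw [← mem_graph_iff hy hb hy.memLp.coeFn_toLp hy.memLp_tau.coeFn_toLp (S := S),
    ← mem_graph_iff hy hb hy.memLp.coeFn_toLp hy.memLp_tau.coeFn_toLp (S := S'), h]

theorem isSelfAdjoint_relOp_iff (hw : IsBoundarySystem q w₁ w₂) (h₁ : InMaxDomain q w₁)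
    (h₂ : InMaxDomain q w₂) (S : Submodule ℂ ((Fin 2 → ℂ) × (Fin 2 → ℂ))) :
    IsSelfAdjoint (relOp q w₁ w₂ S) ↔ orth S = S := by
  rw [LinearPMap.isSelfAdjoint_def, hw.adjoint_relOp h₁ h₂, hw.relOp_injective h₁ h₂]

/-- When `S` is its own double complement, the operator is an adjoint, hence closed. -/
theorem isClosed_relOp (hw : IsBoundarySystem q w₁ w₂) (h₁ : InMaxDomain q w₁)
    (h₂ : InMaxDomain q w₂) {S : Submodule ℂ ((Fin 2 → ℂ) × (Fin 2 → ℂ))}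
    (hS : orth (orth S) = S) : (relOp q w₁ w₂ S).IsClosed := by
  rw [← hS, ← hw.adjoint_relOp h₁ h₂]
  exact LinearPMap.adjoint_isClosed (hw.dense_domain h₁ h₂ _)

end IsBoundarySystem

/-! ### Reflection and conjugation of functions -/

/-- The action of the reflection on boundary values. -/
def reflect (u : Fin 2 → ℂ) : Fin 2 → ℂ := ![u 0, -u 1]

theorem IsRegular.comp_neg {y : ℝ → ℂ} (hy : IsRegular y) : IsRegular (fun x => y (-x)) := by
  have e : deriv (fun x => y (-x)) = fun x => (-1 : ℂ) • deriv y (-x) := funext fun x => by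
    rw [deriv_comp_neg]; simp
  exact ⟨hy.differentiable.comp differentiable_neg, hy.ac.comp_neg,
    e ▸ hy.ac_deriv.comp_neg.smul (-1)⟩

theorem tau_comp_neg {q : ℝ → ℝ} (hq : ∀ x, q (-x) = q x) (y : ℝ → ℂ) (x : ℝ) :
    tau q (fun x => y (-x)) x = tau q y (-x) := by
  have e : deriv (fun x => y (-x)) = fun x => -deriv y (-x) := funext fun x => deriv_comp_neg _ _
  rw [tau, tau, e, deriv.fun_neg, deriv_comp_neg (f := deriv y), hq, neg_neg]

theorem InMaxDomain.comp_neg {q : ℝ → ℝ} (hq : ∀ x, q (-x) = q x) {y : ℝ → ℂ}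
    (hy : InMaxDomain q y) : InMaxDomain q (fun x => y (-x)) where
  memLp := hy.memLp.comp_measurePreserving (Measure.measurePreserving_neg volume)
  regular := hy.regular.comp_neg
  memLp_tau := by
    rw [funext (tau_comp_neg hq y)]
    exact hy.memLp_tau.comp_measurePreserving (Measure.measurePreserving_neg volume)

theorem deriv_conj (y : ℝ → ℂ) : deriv (fun x => conj (y x)) = fun x => conj (deriv y x) :=
  funext fun _ => deriv.star

theorem IsRegular.conj {y : ℝ → ℂ} (hy : IsRegular y) : IsRegular (fun x => conj (y x)) :=
  ⟨fun x => (hy.differentiable x).star, hy.ac.conj, deriv_conj y ▸ hy.ac_deriv.conj⟩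

theorem tau_conj (q : ℝ → ℝ) (y : ℝ → ℂ) :
    tau q (fun x => conj (y x)) = fun x => conj (tau q y x) := by
  funext x
  simp only [tau, deriv_conj, map_sub, map_neg, map_mul, Complex.conj_ofReal]

theorem InMaxDomain.conj {q : ℝ → ℝ} {y : ℝ → ℂ} (hy : InMaxDomain q y) :
    InMaxDomain q (fun x => conj (y x)) where
  memLp := hy.memLp.star
  regular := hy.regular.conj
  memLp_tau := by
    rw [tau_conj]
    exact hy.memLp_tau.star

namespace IsBoundarySystem

variable {q : ℝ → ℝ} {w₁ w₂ : ℝ → ℂ}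

theorem bracket₁_comp_neg (hw : IsBoundarySystem q w₁ w₂) (y : ℝ → ℂ) :
    bracket w₁ (fun x => y (-x)) = fun x => bracket w₁ y (-x) := by
  funext x
  have h : deriv w₁ (-x) = deriv w₁ x := by
    have e := deriv_comp_neg w₁ x
    rw [funext hw.odd₁, deriv.fun_neg] at e
    exact (neg_injective e).symm
  rw [hw.bracket₁, hw.bracket₁, deriv_comp_neg, hw.odd₁, h]
  ring

theorem bracket₂_comp_neg (hw : IsBoundarySystem q w₁ w₂) (y : ℝ → ℂ) :
    bracket w₂ (fun x => y (-x)) = fun x => -bracket w₂ y (-x) := by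
  funext x
  have h : deriv w₂ (-x) = -deriv w₂ x := by
    have e := deriv_comp_neg w₂ x
    rw [funext hw.even₂] at e
    rw [e, neg_neg]
  rw [hw.bracket₂, hw.bracket₂, deriv_comp_neg, hw.even₂, h]
  ring

/-- Reflection exchanges the two ends and negates derivatives; the parity of `w₁` absorbs that sign,
the parity of `w₂` does not. -/
theorem hasBoundaryValues_comp_neg (hw : IsBoundarySystem q w₁ w₂) {y : ℝ → ℂ}
    {α β : Fin 2 → ℂ} (hb : HasBoundaryValues w₁ w₂ y α β) :
    HasBoundaryValues w₁ w₂ (fun x => y (-x)) (reflect β) (reflect α) := by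
  constructor
  · rw [hw.bracket₁_comp_neg]
    exact hb.beta₁.comp tendsto_neg_atBot_atTop
  · rw [hw.bracket₂_comp_neg]
    exact (hb.beta₂.comp tendsto_neg_atBot_atTop).neg
  · rw [hw.bracket₁_comp_neg]
    exact hb.alpha₁.comp tendsto_neg_atTop_atBot
  · rw [hw.bracket₂_comp_neg]
    exact (hb.alpha₂.comp tendsto_neg_atTop_atBot).neg

theorem hasBoundaryValues_conj (hw : IsBoundarySystem q w₁ w₂) {y : ℝ → ℂ}
    {α β : Fin 2 → ℂ} (hb : HasBoundaryValues w₁ w₂ y α β) :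
    HasBoundaryValues w₁ w₂ (fun x => conj (y x)) (star α) (star β) := by
  have e1 : bracket w₁ (fun x => conj (y x)) = fun x => conj (bracket w₁ y x) := by
    funext x
    simp only [hw.bracket₁, deriv_conj, map_sub, map_mul, hw.conj₁, hw.conj_deriv₁]
  have e2 : bracket w₂ (fun x => conj (y x)) = fun x => conj (bracket w₂ y x) := by
    funext x
    simp only [hw.bracket₂, deriv_conj, map_sub, map_mul, hw.conj₂, hw.conj_deriv₂]
  constructor <;> simp only [e1, e2]
  exacts [hb.alpha₁.star, hb.alpha₂.star, hb.beta₁.star, hb.beta₂.star]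

end IsBoundarySystem

theorem parity_ae_eq {f : L2R} {y : ℝ → ℂ} (h : f =ᵐ[volume] y) :
    parity f =ᵐ[volume] fun x => y (-x) :=
  EventuallyEq.trans (parity_ae f)
    ((Measure.measurePreserving_neg (volume : Measure ℝ)).quasiMeasurePreserving.ae_eq_comp h)

theorem timeReversal_ae_eq {f : L2R} {y : ℝ → ℂ} (h : f =ᵐ[volume] y) :
    timeReversal f =ᵐ[volume] fun x => conj (y x) := by
  filter_upwards [timeReversal_ae f, h] with x h1 h2
  rw [h1, h2]

theorem parity_parity (f : L2R) : parity (parity f) = f := by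
  refine Lp.ext ((parity_ae_eq (parity_ae_eq (EventuallyEq.refl _ f))).trans ?_)
  simp only [neg_neg]
  exact EventuallyEq.refl _ _

/-! ### The classes of operators in terms of graphs -/

/-- Because `P` is an involution, the domain and value conditions merge into one statement: `P × P`
matches the graph of `H` with that of its adjoint. -/
theorem isPSelfAdjoint_iff_graph {H : L2R →ₗ.[ℂ] L2R} :
    IsPSelfAdjoint H ↔ H.IsClosed ∧ Dense (H.domain : Set L2R) ∧
      ∀ f k : L2R, (f, k) ∈ H.graph ↔ (parity f, parity k) ∈ H.adjoint.graph := by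
  refine and_congr_right fun _ => and_congr_right fun _ => ⟨?_, ?_⟩
  · rintro ⟨h1, h2⟩ f k
    constructor
    · intro hfk
      have hf := LinearPMap.mem_domain_of_mem_graph hfk
      rw [← LinearPMap.image_iff ((h1 f).1 hf), (LinearPMap.image_iff hf).2 hfk,
        h2 f hf ((h1 f).1 hf), parity_parity]
    · intro hfk
      have hf := LinearPMap.mem_domain_of_mem_graph hfk
      rw [← LinearPMap.image_iff ((h1 f).2 hf), h2 f ((h1 f).2 hf) hf,
        ← (LinearPMap.image_iff hf).2 hfk, parity_parity]
  · intro h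
    refine ⟨fun f => ⟨fun hf => ?_, fun hf => ?_⟩, fun f hf hf' => ?_⟩
    · exact LinearPMap.mem_domain_of_mem_graph ((h f _).1 (H.mem_graph ⟨f, hf⟩))
    · refine LinearPMap.mem_domain_of_mem_graph
        ((h f (parity (H.adjoint ⟨parity f, hf⟩))).2 ?_)
      rw [parity_parity]
      exact H.adjoint.mem_graph ⟨parity f, hf⟩
    · have h1 := (h f _).1 (H.mem_graph ⟨f, hf⟩)
      rw [← (LinearPMap.image_iff hf').2 h1, parity_parity]

theorem isPTSymmetric_iff_graph {H : L2R →ₗ.[ℂ] L2R} :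
    IsPTSymmetric H ↔ H.IsClosed ∧ Dense (H.domain : Set L2R) ∧
      ∀ f k : L2R, (f, k) ∈ H.graph → (PT f, PT k) ∈ H.graph := by
  refine and_congr_right fun _ => and_congr_right fun _ => ⟨?_, ?_⟩
  · intro h f k hfk
    have hf := LinearPMap.mem_domain_of_mem_graph hfk
    obtain ⟨h1, h2⟩ := h ⟨f, hf⟩
    rw [← LinearPMap.image_iff h1, (LinearPMap.image_iff hf).2 hfk, h2]
  · rintro h ⟨f, hf⟩
    have h1 := h f _ (H.mem_graph ⟨f, hf⟩)
    exact ⟨LinearPMap.mem_domain_of_mem_graph h1, (LinearPMap.image_iff _).2 h1⟩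

/-! ### `P`-self-adjointness and `PT` symmetry in terms of boundary relations. -/

namespace IsBoundarySystem

variable {q : ℝ → ℝ} {w₁ w₂ : ℝ → ℂ}

theorem isPSelfAdjoint_relOp_iff (hw : IsBoundarySystem q w₁ w₂) (hq : ∀ x, q (-x) = q x)
    (h₁ : InMaxDomain q w₁) (h₂ : InMaxDomain q w₂)
    {S : Submodule ℂ ((Fin 2 → ℂ) × (Fin 2 → ℂ))} (hS : orth (orth S) = S) :
    IsPSelfAdjoint (relOp q w₁ w₂ S) ↔
      ∀ α β, (α, β) ∈ S ↔ (reflect β, reflect α) ∈ orth S := by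
  have key : ∀ {y : ℝ → ℂ} {α β : Fin 2 → ℂ} {f k : L2R}, InMaxDomain q y →
      HasBoundaryValues w₁ w₂ y α β → f =ᵐ[volume] y → k =ᵐ[volume] tau q y →
      (((f, k) ∈ (relOp q w₁ w₂ S).graph ↔
        (parity f, parity k) ∈ (relOp q w₁ w₂ (orth S)).graph) ↔
      ((α, β) ∈ S ↔ (reflect β, reflect α) ∈ orth S)) := by
    intro y α β f k hy hb hf hk
    rw [mem_graph_iff hy hb hf hk, mem_graph_iff (hy.comp_neg hq)
      (hw.hasBoundaryValues_comp_neg hb) (parity_ae_eq hf)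
      (by rw [funext (tau_comp_neg hq y)]; exact parity_ae_eq hk)]
  rw [isPSelfAdjoint_iff_graph, hw.adjoint_relOp h₁ h₂]
  constructor
  · rintro ⟨-, -, h⟩ α β
    obtain ⟨y, hy, hb⟩ := hw.exists_hasBoundaryValues h₁ h₂ α β
    exact (key hy hb hy.memLp.coeFn_toLp hy.memLp_tau.coeFn_toLp).1 (h _ _)
  · intro h
    refine ⟨hw.isClosed_relOp h₁ h₂ hS, hw.dense_domain h₁ h₂ S, fun f k => ⟨fun H => ?_,
      fun H => ?_⟩⟩
    · obtain ⟨y, hy, hf, hk, α, β, hb, -⟩ := mem_graph_relOp.1 H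
      exact ((key hy hb hf hk).2 (h α β)).1 H
    · obtain ⟨y, hy, hf, hk, α, β, hb, -⟩ := mem_graph_relOp.1 H
      have hf' := parity_ae_eq hf
      have hk' := parity_ae_eq hk
      rw [parity_parity] at hf' hk'
      rw [← funext (tau_comp_neg hq y)] at hk'
      exact ((key (hy.comp_neg hq) (hw.hasBoundaryValues_comp_neg hb) hf' hk').2 (h _ _)).2 H

theorem isPTSymmetric_relOp_iff (hw : IsBoundarySystem q w₁ w₂) (hq : ∀ x, q (-x) = q x)
    (h₁ : InMaxDomain q w₁) (h₂ : InMaxDomain q w₂)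
    {S : Submodule ℂ ((Fin 2 → ℂ) × (Fin 2 → ℂ))} (hS : orth (orth S) = S) :
    IsPTSymmetric (relOp q w₁ w₂ S) ↔
      ∀ α β, (α, β) ∈ S → (reflect (star β), reflect (star α)) ∈ S := by
  have key : ∀ {y : ℝ → ℂ} {α β : Fin 2 → ℂ} {f k : L2R}, InMaxDomain q y →
      HasBoundaryValues w₁ w₂ y α β → f =ᵐ[volume] y → k =ᵐ[volume] tau q y →
      ((PT f, PT k) ∈ (relOp q w₁ w₂ S).graph ↔ (reflect (star β), reflect (star α)) ∈ S) := by
    intro y α β f k hy hb hf hk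
    refine mem_graph_iff (hy.conj.comp_neg hq)
      (hw.hasBoundaryValues_comp_neg (hw.hasBoundaryValues_conj hb))
      (parity_ae_eq (timeReversal_ae_eq hf)) ?_
    rw [funext (tau_comp_neg hq fun x => conj (y x)), tau_conj]
    exact parity_ae_eq (timeReversal_ae_eq hk)
  rw [isPTSymmetric_iff_graph]
  constructor
  · rintro ⟨-, -, h⟩ α β hαβ
    obtain ⟨y, hy, hb⟩ := hw.exists_hasBoundaryValues h₁ h₂ α β
    have hf := hy.memLp.coeFn_toLp
    have hk := hy.memLp_tau.coeFn_toLp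
    exact (key hy hb hf hk).1 (h _ _ ((mem_graph_iff hy hb hf hk).2 hαβ))
  · intro h
    refine ⟨hw.isClosed_relOp h₁ h₂ hS, hw.dense_domain h₁ h₂ S, fun f k H => ?_⟩
    obtain ⟨y, hy, hf, hk, α, β, hb, hs⟩ := mem_graph_relOp.1 H
    exact (key hy hb hf hk).2 (h α β hs)

end IsBoundarySystem

/-! ### Mixed boundary conditions -/

section Mixed

variable {a b c d : ℂ}

theorem mem_mixedRel₁ {α β : Fin 2 → ℂ} : (α, β) ∈ mixedRel₁ !![a, b; c, d] ↔
    α 0 = a * β 0 + b * β 1 ∧ α 1 = c * β 0 + d * β 1 := by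
  change α = _ ↔ _
  rw [funext_iff, Fin.forall_fin_two]
  simp [Matrix.mulVec, dotProduct, Fin.sum_univ_two]

/-- The adjoint of a matrix for the standard symplectic form. -/
def sharp (M : Matrix (Fin 2) (Fin 2) ℂ) : Matrix (Fin 2) (Fin 2) ℂ :=
  !![conj (M 1 1), -conj (M 0 1); -conj (M 1 0), conj (M 0 0)]

theorem sharp_sharp (M : Matrix (Fin 2) (Fin 2) ℂ) : sharp (sharp M) = M := by
  ext i j
  fin_cases i <;> fin_cases j <;> simp [sharp]

theorem symp_mulVec (M : Matrix (Fin 2) (Fin 2) ℂ) (u v : Fin 2 → ℂ) :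
    symp (M *ᵥ u) v = symp u (sharp M *ᵥ v) := by
  simp only [symp, sharp, Matrix.mulVec, dotProduct, Fin.sum_univ_two, map_add, map_mul,
    Matrix.of_apply, Matrix.cons_val_zero, Matrix.cons_val_one]
  ring

theorem eq_of_forall_symp_eq {v v' : Fin 2 → ℂ} (h : ∀ u, symp u v = symp u v') : v = v' := by
  have h0 := h ![1, 0]
  have h1 := h ![0, 1]
  simp [symp] at h0 h1
  funext i
  fin_cases i
  exacts [h1, h0]

/-- Moving `M` across the symplectic form gives `sharp M`, and nondegeneracy of the form gives the
equality of vectors. The roles of `α` and `β` are exchanged. -/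
theorem orth_mixedRel₁ (M : Matrix (Fin 2) (Fin 2) ℂ) :
    orth (mixedRel₁ M) = mixedRel₂ (sharp M) := by
  ext ⟨α, β⟩
  constructor
  · intro h
    refine eq_of_forall_symp_eq fun u => ?_
    rw [← symp_mulVec]
    exact h (M *ᵥ u, u) rfl
  · rintro (h : β = _) ⟨α', β'⟩ (h' : α' = _)
    change symp β' β = symp α' α
    rw [h, h', symp_mulVec]

theorem orth_mixedRel₂ (M : Matrix (Fin 2) (Fin 2) ℂ) :
    orth (mixedRel₂ M) = mixedRel₁ (sharp M) := by
  ext ⟨α, β⟩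
  constructor
  · intro h
    refine eq_of_forall_symp_eq fun u => ?_
    rw [← symp_mulVec]
    exact (h (u, M *ᵥ u) rfl).symm
  · rintro (h : α = _) ⟨α', β'⟩ (h' : β' = _)
    change symp β' β = symp α' α
    rw [h, h', symp_mulVec]

theorem mixedRel₂_eq_mixedRel₁_iff (M N : Matrix (Fin 2) (Fin 2) ℂ) :
    mixedRel₂ N = mixedRel₁ M ↔ N * M = 1 := by
  constructor
  · intro h
    refine Matrix.mulVec_injective (funext fun v => ?_)
    have h1 : (M *ᵥ v, v) ∈ mixedRel₂ N := h ▸ (show (M *ᵥ v, v) ∈ mixedRel₁ M from rfl)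
    rw [Matrix.one_mulVec, ← Matrix.mulVec_mulVec]
    exact Eq.symm h1
  · intro h
    have h' := mul_eq_one_comm.1 h
    ext ⟨α, β⟩
    change β = N *ᵥ α ↔ α = M *ᵥ β
    constructor
    · rintro rfl
      rw [Matrix.mulVec_mulVec, h', Matrix.one_mulVec]
    · rintro rfl
      rw [Matrix.mulVec_mulVec, h, Matrix.one_mulVec]

theorem sharp_mul_eq_one_iff : sharp !![a, b; c, d] * !![a, b; c, d] = 1 ↔
    conj d * a - conj b * c = 1 ∧ conj a * c = conj c * a ∧ conj d * b = conj b * d := by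
  rw [← Matrix.ext_iff, Fin.forall_fin_two, Fin.forall_fin_two, Fin.forall_fin_two]
  simp only [sharp, Matrix.mul_apply, Fin.sum_univ_two, Matrix.of_apply, Matrix.cons_val_zero,
    Matrix.cons_val_one, Matrix.cons_val', Matrix.one_apply_eq, Matrix.cons_val_fin_one,
    Matrix.one_apply_ne (show (0 : Fin 2) ≠ 1 by decide),
    Matrix.one_apply_ne (show (1 : Fin 2) ≠ 0 by decide)]
  constructor
  · rintro ⟨⟨h1, h2⟩, h3, -⟩
    exact ⟨by linear_combination h1, by linear_combination h3, by linear_combination h2⟩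
  · rintro ⟨h1, h2, h3⟩
    -- The lower diagonal entry is the conjugate of the upper one, so three equations suffice.
    have h4 := congrArg conj h1
    simp only [map_sub, map_mul, Complex.conj_conj, map_one] at h4
    exact ⟨⟨by linear_combination h1, by linear_combination h3⟩, by linear_combination h2,
      by linear_combination h4⟩

theorem reflect_iff : (∀ α β : Fin 2 → ℂ, (α, β) ∈ mixedRel₁ !![a, b; c, d] ↔
      (reflect α, reflect β) ∈ mixedRel₁ (sharp !![a, b; c, d])) ↔
    d = conj a ∧ b.im = 0 ∧ c.im = 0 := by
  have e : ∀ α β : Fin 2 → ℂ, (reflect α, reflect β) ∈ mixedRel₁ (sharp !![a, b; c, d]) ↔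
      α 0 = conj d * β 0 + conj b * β 1 ∧ α 1 = conj c * β 0 + conj a * β 1 := by
    intro α β
    rw [sharp, mem_mixedRel₁]
    simp only [reflect, Matrix.of_apply, Matrix.cons_val_zero, Matrix.cons_val_one, Matrix.cons_val',
      Matrix.cons_val_fin_one]
    refine and_congr ⟨fun h => ?_, fun h => ?_⟩ ⟨fun h => ?_, fun h => ?_⟩
    · linear_combination h
    · linear_combination h
    · linear_combination -h
    · linear_combination -h
  simp only [e, mem_mixedRel₁]
  constructor
  · intro h
    have h0 := (h ![a, c] ![1, 0]).1 (by simp)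
    have h1 := (h ![b, d] ![0, 1]).1 (by simp)
    simp only [Matrix.cons_val_zero, Matrix.cons_val_one, mul_one, mul_zero, add_zero,
      zero_add] at h0 h1
    exact ⟨h1.2, Complex.conj_eq_iff_im.1 h1.1.symm, Complex.conj_eq_iff_im.1 h0.2.symm⟩
  · rintro ⟨rfl, hb, hc⟩ α β
    rw [Complex.conj_eq_iff_im.2 hb, Complex.conj_eq_iff_im.2 hc, Complex.conj_conj]

/-- These are the entries of `M R conj(M) R = 1` with `R = diag(1, -1)`, read off by testing on the
two basis vectors. -/
theorem reflect_star_iff : (∀ α β : Fin 2 → ℂ, (α, β) ∈ mixedRel₁ !![a, b; c, d] →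
      (reflect (star β), reflect (star α)) ∈ mixedRel₁ !![a, b; c, d]) ↔
    a * conj a - b * conj c = 1 ∧ d * conj d - c * conj b = 1 ∧
      a * conj b = b * conj d ∧ c * conj a = d * conj c := by
  simp only [mem_mixedRel₁, reflect, Matrix.cons_val_zero, Matrix.cons_val_one, Pi.star_apply,
    ← starRingEnd_apply]
  constructor
  · intro h
    have h0 := h ![a, c] ![1, 0] (by simp)
    have h1 := h ![b, d] ![0, 1] (by simp)
    simp only [Matrix.cons_val_zero, Matrix.cons_val_one, map_one, map_zero] at h0 h1
    exact ⟨by linear_combination -h0.1, by linear_combination h1.2, by linear_combination -h1.1,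
      by linear_combination -h0.2⟩
  · rintro ⟨h1, h2, h3, h4⟩ α β ⟨e1, e2⟩
    rw [e1, e2]
    simp only [map_add, map_mul]
    constructor
    · linear_combination -conj (β 0) * h1 - conj (β 1) * h3
    · linear_combination conj (β 1) * h2 - conj (β 0) * h4

variable {q : ℝ → ℝ} {w₁ w₂ : ℝ → ℂ}

/-- The three classes for an operator given by mixed boundary conditions. -/
theorem mixedOp_iff (hw : IsBoundarySystem q w₁ w₂) (hq : ∀ x, q (-x) = q x)
    (h₁ : InMaxDomain q w₁) (h₂ : InMaxDomain q w₂) {A : L2R →ₗ.[ℂ] L2R}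
    (hA : A = mixedOp₁ q w₁ w₂ !![a, b; c, d] ∨ A = mixedOp₂ q w₁ w₂ !![a, b; c, d]) :
    (IsSelfAdjoint A ↔
      conj d * a - conj b * c = 1 ∧ conj a * c = conj c * a ∧ conj d * b = conj b * d) ∧
    (IsPSelfAdjoint A ↔ d = conj a ∧ b.im = 0 ∧ c.im = 0) ∧
    (IsPTSymmetric A ↔ a * conj a - b * conj c = 1 ∧ d * conj d - c * conj b = 1 ∧
      a * conj b = b * conj d ∧ c * conj a = d * conj c) := by
  rcases hA with rfl | rfl
  · set M := !![a, b; c, d] with hM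
    have hS : orth (orth (mixedRel₁ M)) = mixedRel₁ M := by
      rw [orth_mixedRel₁, orth_mixedRel₂, sharp_sharp]
    refine ⟨?_, ?_, ?_⟩
    · rw [← sharp_mul_eq_one_iff, ← mixedRel₂_eq_mixedRel₁_iff, ← orth_mixedRel₁]
      exact hw.isSelfAdjoint_relOp_iff h₁ h₂ _
    · rw [← reflect_iff]
      refine (hw.isPSelfAdjoint_relOp_iff hq h₁ h₂ hS).trans ?_
      rw [orth_mixedRel₁]
      exact Iff.rfl
    · rw [← reflect_star_iff]
      exact hw.isPTSymmetric_relOp_iff hq h₁ h₂ hS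
  · set M := !![a, b; c, d] with hM
    have hS : orth (orth (mixedRel₂ M)) = mixedRel₂ M := by
      rw [orth_mixedRel₂, orth_mixedRel₁, sharp_sharp]
    refine ⟨?_, ?_, ?_⟩
    · rw [← sharp_mul_eq_one_iff, mul_eq_one_comm, ← mixedRel₂_eq_mixedRel₁_iff, eq_comm,
        ← orth_mixedRel₂]
      exact hw.isSelfAdjoint_relOp_iff h₁ h₂ _
    · rw [← reflect_iff]
      refine (hw.isPSelfAdjoint_relOp_iff hq h₁ h₂ hS).trans ?_
      rw [orth_mixedRel₂]
      -- Exchanging `α` and `β` turns `mixedRel₂` into `mixedRel₁`, so the condition is the one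
      -- already treated.
      exact forall_comm
    · rw [← reflect_star_iff]
      exact (hw.isPTSymmetric_relOp_iff hq h₁ h₂ hS).trans forall_comm

end Mixed

/-! ### The resulting conditions on the coefficients -/

section Coefficients

variable {a b c d : ℂ}

theorem selfAdjoint_and_pSelfAdjoint_iff :
    ((conj d * a - conj b * c = 1 ∧ conj a * c = conj c * a ∧ conj d * b = conj b * d) ∧
      d = conj a ∧ b.im = 0 ∧ c.im = 0) ↔
    a.im = 0 ∧ b.im = 0 ∧ c.im = 0 ∧ d.im = 0 ∧ a = d ∧ a ^ 2 - b * c = 1 := by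
  constructor
  · rintro ⟨⟨h1, h2, h3⟩, rfl, hb, hc⟩
    rw [Complex.conj_conj, Complex.conj_eq_iff_im.2 hb] at h1 h3
    rw [Complex.conj_eq_iff_im.2 hc] at h2
    have h4 := congrArg conj h1
    simp only [map_sub, map_mul, map_one, Complex.conj_eq_iff_im.2 hb,
      Complex.conj_eq_iff_im.2 hc] at h4
    -- Here `a² = 1 + bc` is real. If `a` were not real it would be purely imaginary, and the
    -- off-diagonal relation would force `c = 0`, so `a² = 1` and `|a|² = -1`.
    have ha : conj a = a := by
      by_contra hne
      have hne' : conj a - a ≠ 0 := sub_ne_zero.2 hne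
      have hc0 : c = 0 := (mul_eq_zero.1 (show (conj a - a) * c = 0 by
        linear_combination h2)).resolve_left hne'
      have hs : conj a + a = 0 := (mul_eq_zero.1 (show (conj a - a) * (conj a + a) = 0 by
        linear_combination h4 - h1)).resolve_left hne'
      have h5 : a * conj a = -1 := by
        rw [hc0] at h1
        linear_combination a * hs - h1
      rw [Complex.mul_conj] at h5
      have h6 := congrArg Complex.re h5
      simp only [Complex.ofReal_re, Complex.neg_re, Complex.one_re] at h6
      linarith [Complex.normSq_nonneg a]
    have ha' := Complex.conj_eq_iff_im.1 ha
    exact ⟨ha', hb, hc, by rw [ha, ha'], ha.symm, by linear_combination h1⟩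
  · rintro ⟨ha, hb, hc, -, rfl, h⟩
    rw [Complex.conj_eq_iff_im.2 ha, Complex.conj_eq_iff_im.2 hb, Complex.conj_eq_iff_im.2 hc]
    exact ⟨⟨by linear_combination h, by ring, by ring⟩, rfl, hb, hc⟩

theorem pTSymmetric_of_real (h : a.im = 0 ∧ b.im = 0 ∧ c.im = 0 ∧ d.im = 0 ∧ a = d ∧
      a ^ 2 - b * c = 1) :
    a * conj a - b * conj c = 1 ∧ d * conj d - c * conj b = 1 ∧
      a * conj b = b * conj d ∧ c * conj a = d * conj c := by
  obtain ⟨ha, hb, hc, -, rfl, h⟩ := h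
  rw [Complex.conj_eq_iff_im.2 ha, Complex.conj_eq_iff_im.2 hb, Complex.conj_eq_iff_im.2 hc]
  exact ⟨by linear_combination h, by linear_combination h, by ring, by ring⟩

theorem pSelfAdjoint_and_pTSymmetric_iff :
    ((d = conj a ∧ b.im = 0 ∧ c.im = 0) ∧
      (a * conj a - b * conj c = 1 ∧ d * conj d - c * conj b = 1 ∧
        a * conj b = b * conj d ∧ c * conj a = d * conj c)) ↔
    b.im = 0 ∧ c.im = 0 ∧ d = conj a ∧ (‖a‖ : ℂ) ^ 2 - b * c = 1 := by
  rw [← Complex.mul_conj']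
  constructor
  · rintro ⟨⟨hd, hb, hc⟩, h1, -⟩
    rw [Complex.conj_eq_iff_im.2 hc] at h1
    exact ⟨hb, hc, hd, h1⟩
  · rintro ⟨hb, hc, rfl, h⟩
    rw [Complex.conj_conj, Complex.conj_eq_iff_im.2 hb, Complex.conj_eq_iff_im.2 hc]
    exact ⟨⟨rfl, hb, hc⟩, h, by linear_combination h, by ring, by ring⟩

theorem exists_exp_eq {u : ℂ} (hu : conj u * u = 1) :
    ∃ φ : ℝ, Complex.exp (2 * Complex.I * φ) = u := by
  have hn : ‖u‖ = 1 := by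
    rw [mul_comm, Complex.mul_conj', ← Complex.ofReal_pow, ← Complex.ofReal_one,
      Complex.ofReal_inj] at hu
    exact (pow_eq_one_iff_of_nonneg (norm_nonneg u) two_ne_zero).1 hu
  refine ⟨Complex.arg u / 2, ?_⟩
  have h := Complex.norm_mul_exp_arg_mul_I u
  rw [hn, Complex.ofReal_one, one_mul] at h
  rw [← h]
  congr 1
  rw [h]
  push_cast
  ring

/-- The line `e^{iφ}ℝ` is the fixed set of the reflection `z ↦ e^{2iφ} conj z`. -/
theorem exp_mul_im_eq_zero_iff (φ : ℝ) (z : ℂ) :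
    (Complex.exp (-(Complex.I * φ)) * z).im = 0 ↔
      Complex.exp (2 * Complex.I * φ) * conj z = z := by
  have e1 : conj (Complex.exp (-(Complex.I * φ))) = Complex.exp (Complex.I * φ) := by
    rw [← Complex.exp_conj]
    simp
  have e2 : Complex.exp (-(Complex.I * φ)) * Complex.exp (Complex.I * φ) = 1 := by
    rw [← Complex.exp_add, neg_add_cancel, Complex.exp_zero]
  have e3 : Complex.exp (2 * Complex.I * φ) =
      Complex.exp (Complex.I * φ) * Complex.exp (Complex.I * φ) := by
    rw [← Complex.exp_add]
    ring_nf
  rw [← Complex.conj_eq_iff_im, map_mul, e1, e3]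
  constructor <;> intro h
  · linear_combination Complex.exp (Complex.I * φ) * h + z * e2
  · linear_combination Complex.exp (-(Complex.I * φ)) * h -
      conj z * Complex.exp (Complex.I * φ) * e2

theorem selfAdjoint_and_pTSymmetric_iff :
    ((conj d * a - conj b * c = 1 ∧ conj a * c = conj c * a ∧ conj d * b = conj b * d) ∧
      (a * conj a - b * conj c = 1 ∧ d * conj d - c * conj b = 1 ∧
        a * conj b = b * conj d ∧ c * conj a = d * conj c)) ↔
    ∃ φ : ℝ,
      (Complex.exp (-(Complex.I * φ)) * a).im = 0 ∧
      (Complex.exp (-(Complex.I * φ)) * b).im = 0 ∧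
      (Complex.exp (-(Complex.I * φ)) * c).im = 0 ∧
      (Complex.exp (-(Complex.I * φ)) * d).im = 0 ∧
      d = Complex.exp (2 * Complex.I * φ) * conj a ∧
      a * d - b * c = Complex.exp (2 * Complex.I * φ) := by
  simp only [exp_mul_im_eq_zero_iff]
  constructor
  · rintro ⟨⟨h1, h2, h3⟩, h4, h5, -, -⟩
    have h1' := congrArg conj h1
    simp only [map_sub, map_mul, Complex.conj_conj, map_one] at h1'
    -- With `u = ad - bc`, self-adjointness says `u conj(M) = M` entrywise; taking determinants
    -- gives `|u| = 1`, whence the phase `φ`.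
    have ha : (a * d - b * c) * conj a = a := by linear_combination a * h1' - b * h2
    have hb : (a * d - b * c) * conj b = b := by linear_combination b * h1 - a * h3
    have hc : (a * d - b * c) * conj c = c := by linear_combination c * h1' - d * h2
    have hd : (a * d - b * c) * conj d = d := by linear_combination d * h1 - c * h3
    have hu0 : a * d - b * c ≠ 0 := by
      intro h
      rw [h, zero_mul] at ha hb
      rw [← ha, ← hb] at h1
      simp at h1
    have hu : conj (a * d - b * c) * (a * d - b * c) = 1 := by
      refine mul_right_cancel₀ hu0 ?_
      simp only [map_sub, map_mul]
      linear_combination (a * d - b * c) * conj d * ha + a * hd -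
        (a * d - b * c) * conj c * hb - b * hc
    -- Via `u conj(M) = M`, `PT` symmetry gives `a² - bc = u = d² - bc`; adding these and
    -- subtracting `2(ad - bc) = 2u` yields `(a - d)² = 0`.
    have had : a = d := by
      have e : (a - d) ^ 2 = 0 := by
        linear_combination (a * d - b * c) * h4 - a * ha + b * hc + (a * d - b * c) * h5 -
          d * hd + c * hb
      exact sub_eq_zero.1 (pow_eq_zero_iff two_ne_zero |>.1 e)
    obtain ⟨φ, hφ⟩ := exists_exp_eq hu
    refine ⟨φ, ?_⟩
    rw [hφ]
    exact ⟨ha, hb, hc, hd, by rw [ha, had], rfl⟩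
  · rintro ⟨φ, ha, hb, hc, hd, hda, hdet⟩
    have hu0 := Complex.exp_ne_zero (2 * Complex.I * φ)
    set u := Complex.exp (2 * Complex.I * φ)
    rw [ha] at hda
    subst hda
    -- Multiplying by `u` lets `u conj z = z` remove every conjugate.
    refine ⟨⟨?_, ?_, ?_⟩, ?_, ?_, ?_, ?_⟩ <;> refine mul_left_cancel₀ hu0 ?_
    · linear_combination d * ha - c * hb + hdet
    · linear_combination c * ha - d * hc
    · linear_combination b * ha - d * hb
    · linear_combination d * ha - b * hc + hdet
    · linear_combination d * ha - c * hb + hdet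
    · linear_combination d * hb - b * ha
    · linear_combination c * ha - d * hc

end Coefficients

end PTQM

end

theorem mainTheorem5
    (q : ℝ → ℝ) (hq : LocallyIntegrable q volume) (hq_even : ∀ x, q (-x) = q x)
    (hq_top : PTQM.LimitCircleAtTop q) (hq_bot : PTQM.LimitCircleAtBot q)
    (w₁ w₂ : ℝ → ℂ) (hw : PTQM.IsBoundarySystem q w₁ w₂)
    (a b c d : ℂ) (A : PTQM.L2R →ₗ.[ℂ] PTQM.L2R)
    (hA : A = PTQM.mixedOp₁ q w₁ w₂ !![a, b; c, d] ∨
      A = PTQM.mixedOp₂ q w₁ w₂ !![a, b; c, d]) :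
    ((PTQM.IsPTSymmetric A ∧ IsSelfAdjoint A ∧ PTQM.IsPSelfAdjoint A) ↔
      (a.im = 0 ∧ b.im = 0 ∧ c.im = 0 ∧ d.im = 0 ∧ a = d ∧ a ^ 2 - b * c = 1)) ∧
    ((IsSelfAdjoint A ∧ PTQM.IsPSelfAdjoint A) ↔
      (a.im = 0 ∧ b.im = 0 ∧ c.im = 0 ∧ d.im = 0 ∧ a = d ∧ a ^ 2 - b * c = 1)) ∧
    ((IsSelfAdjoint A ∧ PTQM.IsPSelfAdjoint A) → PTQM.IsPTSymmetric A) ∧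
    ((IsSelfAdjoint A ∧ PTQM.IsPTSymmetric A) ↔
      ∃ φ : ℝ,
        (Complex.exp (-(Complex.I * φ)) * a).im = 0 ∧
        (Complex.exp (-(Complex.I * φ)) * b).im = 0 ∧
        (Complex.exp (-(Complex.I * φ)) * c).im = 0 ∧
        (Complex.exp (-(Complex.I * φ)) * d).im = 0 ∧
        d = Complex.exp (2 * Complex.I * φ) * conj a ∧
        a * d - b * c = Complex.exp (2 * Complex.I * φ)) ∧
    ((PTQM.IsPSelfAdjoint A ∧ PTQM.IsPTSymmetric A) ↔
      (b.im = 0 ∧ c.im = 0 ∧ d = conj a ∧ (‖a‖ : ℂ) ^ 2 - b * c = 1)) := by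
  obtain ⟨hSA, hP, hPT⟩ := PTQM.mixedOp_iff hw hq_even (hw.sol₁.inMaxDomain hq_top hq_bot)
    (hw.sol₂.inMaxDomain hq_top hq_bot) hA
  rw [hSA, hP, hPT, PTQM.selfAdjoint_and_pSelfAdjoint_iff]
  exact ⟨⟨And.right, fun h => ⟨PTQM.pTSymmetric_of_real h, h⟩⟩, Iff.rfl,
    PTQM.pTSymmetric_of_real, PTQM.selfAdjoint_and_pTSymmetric_iff,
    PTQM.pSelfAdjoint_and_pTSymmetric_iff⟩
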